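/- Let $n\ge 3$, let $\mathbb{B}^n=\{x\in\mathbb{R}^n:|x|<1\}$ be the open unit ball, $\mathbb{S}^{n-1}=\{x\in\mathbb{R}^n:|x|=1\}$ the unit sphere, and let $\nu$ be Lebesgue measure on $\mathbb{B}^n$, normalized so that $\nu(\mathbb{B}^n)=1$. For a $C^2$ map $u$ on $\mathbb{B}^n$ with values in $\mathbb{R}^n$, the hyperbolic Laplacian is defined (componentwise) by $$\Delta_h u(x)=(1-|x|^2)^2\,\Delta u(x)+2(n-2)(1-|x|^2)\sum_{i=1}^n x_i\frac{\partial u}{\partial x_i}(x).$$ Let $0<\alpha\le 1$ and $n<p\le\infty$. Suppose that $u\in C^2(\mathbb{B}^n,\mathbb{R}^n)\cap C(\overline{\mathbb{B}^n},\mathbb{R}^n)$ and that $$(1-|y|^2)^{-1-\alpha}\,\Delta_h u(y)\in L^p(\mathbb{B}^n,d\nu).$$ If $u$ is $\alpha$-Hölder on $\mathbb{S}^{n-1}$, i.e. there is a constant $C$ with $|u(x)-u(y)|\le C|x-y|^\alpha$ for all $x,y\in\mathbb{S}^{n-1}$, then $u$ is $\alpha$-Hölder on $\overline{\mathbb{B}^n}$,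 i.e. there is a constant $C'$ with $|u(x)-u(y)|\le C'|x-y|^\alpha$ for all $x,y\in\overline{\mathbb{B}^n}$. -/

import Mathlib

open MeasureTheory Metric
open scoped NNReal ENNReal

noncomputable section

/-- The Lebesgue measure on the open unit ball of `ℝⁿ`, normalized to have total mass one. -/
def ballMeasure (n : ℕ) : Measure (EuclideanSpace ℝ (Fin n)) :=
  (volume (ball (0 : EuclideanSpace ℝ (Fin n)) 1))⁻¹ • volume.restrict (ball 0 1)

/-- The hyperbolic Laplacian of the unit ball,
`Δ_h u(x) = (1 - |x|²)² Δu(x) + 2 (n - 2) (1 - |x|²) ∑ i, xᵢ ∂u/∂xᵢ(x)`,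
acting componentwise on maps with values in a real normed space. -/
def hyperbolicLaplacian {n : ℕ} {F : Type*} [NormedAddCommGroup F] [NormedSpace ℝ F]
    (u : EuclideanSpace ℝ (Fin n) → F) (x : EuclideanSpace ℝ (Fin n)) : F :=
  (1 - ‖x‖ ^ 2) ^ 2 • Laplacian.laplacian u x +
    (2 * ((n : ℝ) - 2) * (1 - ‖x‖ ^ 2)) •
      ∑ i : Fin n, x i • fderiv ℝ u x (EuclideanSpace.single i 1)

/-- `f` is `α`-Hölder (Lipschitz for `α = 1`) on the set `s`. -/
def IsHolderOn {X Y : Type*} [PseudoEMetricSpace X] [PseudoEMetricSpace Y]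
    (α : ℝ≥0) (f : X → Y) (s : Set X) : Prop :=
  ∃ C : ℝ≥0, HolderOnWith C α f s

end

/-! Write `ρ(x) = 1 - |x|²`. The operator is `Δ_h u = ρⁿ div(ρ²⁻ⁿ ∇u)`, symmetric for the measure
`ρ⁻ⁿ dx`, and it acts on functions of `s = sinh²(d/2)`, with `d` the hyperbolic distance to a fixed
point `a`, as an ordinary differential operator. Solving that ODE with a right side concentrated at
two scales gives compactly supported kernels `G_ε ≥ 0` with `Δ_h G_ε = k - k_ε`. Green's identity
and `ε → 0` yield the mean value formula `lim ∫ G_ε Δ_h v = ∫ k v - m(a) v(a)`, where `m(a)` is the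
mass of `k` (`tendsto_integral_greenFun_mul`).

By hypothesis `|Δ_h u| ≤ ρ^(1+α) g` with `g ∈ L^p`, `p > n`. Both `G_ε` and its gradient are
controlled by `|y - a|¹⁻ⁿ` after scaling, and this kernel lies in the dual exponent space exactly
because `p > n`. Hence `|∫ G_ε Δ_h u| ≤ const · ρ(a)^α`, uniformly in `ε`, and the same integral for
two nearby centres differs by an extra factor `|a - b| / ρ(a)`.

At the boundary, `|x - ζ|^α + K ρ^α` is a supersolution with `Δ_h ≤ -ρ^α`
(`hyperbolicLaplacian_barrier_le`). The function `g` need not be bounded, so the maximum principle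
is run in integrated form: at an interior maximum `a` of `u - u(ζ) - M · barrier` the mean value
formula has a nonpositive limit, yet for large `M` the barrier beats the potential of `Δ_h u`
(`exists_boundary_upper_bound`). This gives `|u(x) - u(ζ)| ≤ M |x - ζ|^α`.

Inside, subtracting the mean value formulas at `a` and `b` gives a Lipschitz bound at scale `ρ(a)`
(`exists_interior_bound`). Pairs close relative to `ρ` use this bound; all other pairs are joined
through a boundary point (`exists_holder_bound`). -/

namespace HyperbolicBall

open Filter Topology Set

/-! ### Calculus of the hyperbolic Laplacian and its action on the radial variable. -/

section

variable {n : ℕ}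

/-- The partial derivative of `f` in the `i`-th coordinate direction. -/
noncomputable def pderiv (i : Fin n) (f : EuclideanSpace ℝ (Fin n) → ℝ)
    (x : EuclideanSpace ℝ (Fin n)) : ℝ :=
  fderiv ℝ f x (EuclideanSpace.single i 1)

theorem hyperbolicLaplacian_eq {f : EuclideanSpace ℝ (Fin n) → ℝ} {x : EuclideanSpace ℝ (Fin n)}
    (hf : ContDiffAt ℝ 2 f x) :
    hyperbolicLaplacian f x = (1 - ‖x‖ ^ 2) ^ 2 * ∑ i, pderiv i (pderiv i f) x +
      2 * ((n : ℝ) - 2) * (1 - ‖x‖ ^ 2) * ∑ i, x i * pderiv i f x := by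
  have hd : DifferentiableAt ℝ (fderiv ℝ f) x :=
    (hf.fderiv_right (m := 1) (by norm_num)).differentiableAt (by norm_num)
  have hl : Laplacian.laplacian f x = ∑ i, pderiv i (pderiv i f) x := by
    rw [InnerProductSpace.laplacian_eq_iteratedFDeriv_orthonormalBasis f
      (EuclideanSpace.basisFun (Fin n) ℝ)]
    refine Finset.sum_congr rfl fun i _ => ?_
    rw [iteratedFDeriv_two_apply]
    simp only [EuclideanSpace.basisFun_apply, Matrix.cons_val_zero, Matrix.cons_val_one]
    unfold pderiv
    rw [fderiv_clm_apply hd (differentiableAt_const _)]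
    simp
  simp only [hyperbolicLaplacian, hl, smul_eq_mul]
  rfl

theorem hyperbolicLaplacian_clm_comp {F G : Type*} [NormedAddCommGroup F] [NormedSpace ℝ F]
    [NormedAddCommGroup G] [NormedSpace ℝ G] {f : EuclideanSpace ℝ (Fin n) → F}
    {x : EuclideanSpace ℝ (Fin n)} (hf : ContDiffAt ℝ 2 f x) (l : F →L[ℝ] G) :
    hyperbolicLaplacian (l ∘ f) x = l (hyperbolicLaplacian f x) := by
  have h1 : Laplacian.laplacian (l ∘ f) x = l (Laplacian.laplacian f x) :=
    hf.laplacian_CLM_comp_left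
  have h2 : fderiv ℝ (l ∘ f) x = l ∘L fderiv ℝ f x :=
    ((l.hasFDerivAt (x := f x)).comp x
      (hf.differentiableAt (by norm_num)).hasFDerivAt).fderiv
  simp [hyperbolicLaplacian, h1, h2]

theorem hyperbolicLaplacian_add {f g : EuclideanSpace ℝ (Fin n) → ℝ}
    {x : EuclideanSpace ℝ (Fin n)} (hf : ContDiffAt ℝ 2 f x) (hg : ContDiffAt ℝ 2 g x) :
    hyperbolicLaplacian (fun y => f y + g y) x =
      hyperbolicLaplacian f x + hyperbolicLaplacian g x := by
  have h1 : Laplacian.laplacian (fun y => f y + g y) x = _ := hf.laplacian_add hg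
  have h2 : fderiv ℝ (fun y => f y + g y) x = _ :=
    fderiv_add (hf.differentiableAt (by norm_num)) (hg.differentiableAt (by norm_num))
  simp only [hyperbolicLaplacian, h1, h2, add_apply, smul_eq_mul, mul_add,
    Finset.sum_add_distrib]
  ring

theorem hyperbolicLaplacian_const_mul {f : EuclideanSpace ℝ (Fin n) → ℝ}
    {x : EuclideanSpace ℝ (Fin n)} (hf : ContDiffAt ℝ 2 f x) (c : ℝ) :
    hyperbolicLaplacian (fun y => c * f y) x = c * hyperbolicLaplacian f x :=
  hyperbolicLaplacian_clm_comp hf (c • ContinuousLinearMap.id ℝ ℝ)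

theorem hyperbolicLaplacian_const (c : ℝ) (x : EuclideanSpace ℝ (Fin n)) :
    hyperbolicLaplacian (fun _ => c) x = 0 := by
  have h1 : Laplacian.laplacian (fun _ : EuclideanSpace ℝ (Fin n) => c) x = 0 := by
    simp
  simp [hyperbolicLaplacian, h1]

theorem pderiv_comp {f : EuclideanSpace ℝ (Fin n) → ℝ} {x : EuclideanSpace ℝ (Fin n)} {F : ℝ → ℝ}
    (i : Fin n) (hF : DifferentiableAt ℝ F (f x)) (hf : DifferentiableAt ℝ f x) :
    pderiv i (fun y => F (f y)) x = deriv F (f x) * pderiv i f x := by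
  have := (hF.hasDerivAt.comp_hasFDerivAt x hf.hasFDerivAt).fderiv
  rw [pderiv, show (fun y => F (f y)) = F ∘ f from rfl, this]
  simp [pderiv]

theorem pderiv_mul {f g : EuclideanSpace ℝ (Fin n) → ℝ} {x : EuclideanSpace ℝ (Fin n)}
    (i : Fin n) (hf : DifferentiableAt ℝ f x) (hg : DifferentiableAt ℝ g x) :
    pderiv i (fun y => f y * g y) x = f x * pderiv i g x + g x * pderiv i f x := by
  rw [pderiv, fderiv_fun_mul hf hg]
  simp [pderiv]

theorem pderiv_congr {f g : EuclideanSpace ℝ (Fin n) → ℝ} {x : EuclideanSpace ℝ (Fin n)}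
    (i : Fin n) (h : f =ᶠ[𝓝 x] g) : pderiv i f x = pderiv i g x := by
  rw [pderiv, h.fderiv_eq, pderiv]

theorem differentiableAt_pderiv {f : EuclideanSpace ℝ (Fin n) → ℝ} {x : EuclideanSpace ℝ (Fin n)}
    (i : Fin n) (hf : ContDiffAt ℝ 2 f x) : DifferentiableAt ℝ (pderiv i f) x :=
  ((hf.fderiv_right (m := 1) (by norm_num)).differentiableAt (by norm_num)).clm_apply
    (differentiableAt_const _)

theorem contDiffAt_pderiv {f : EuclideanSpace ℝ (Fin n) → ℝ} {x : EuclideanSpace ℝ (Fin n)}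
    (i : Fin n) (hf : ContDiffAt ℝ 2 f x) : ContDiffAt ℝ 1 (pderiv i f) x :=
  (hf.fderiv_right (m := 1) (by norm_num)).clm_apply contDiffAt_const

/-- Used twice: with `hypS`, where it turns radial problems into an ODE, and with real powers, for
the barrier. -/
theorem hyperbolicLaplacian_comp {f : EuclideanSpace ℝ (Fin n) → ℝ}
    {x : EuclideanSpace ℝ (Fin n)} {F : ℝ → ℝ} (hF : ContDiffAt ℝ 2 F (f x))
    (hf : ContDiffAt ℝ 2 f x) :
    hyperbolicLaplacian (fun y => F (f y)) x =
      deriv (deriv F) (f x) * ((1 - ‖x‖ ^ 2) ^ 2 * ∑ i, pderiv i f x ^ 2) +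
        deriv F (f x) * hyperbolicLaplacian f x := by
  have hev : ∀ᶠ y in 𝓝 x, ContDiffAt ℝ 2 f y ∧ ContDiffAt ℝ 2 F (f y) :=
    (hf.eventually (by simp)).and (hf.continuousAt.eventually (hF.eventually (by simp)))
  have h1 : ∀ i, pderiv i (fun y => F (f y)) =ᶠ[𝓝 x] fun y => deriv F (f y) * pderiv i f y := by
    intro i
    filter_upwards [hev] with y hy
    exact pderiv_comp i (hy.2.differentiableAt (by norm_num)) (hy.1.differentiableAt (by norm_num))
  have hF' : DifferentiableAt ℝ (deriv F) (f x) := by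
    have : ContDiffAt ℝ 1 (deriv F) (f x) := by
      have := (hF.fderiv_right (m := 1) (by norm_num)).clm_apply
        (contDiffAt_const (c := (1 : ℝ)))
      exact this
    exact this.differentiableAt (by norm_num)
  have hfd := hf.differentiableAt (by norm_num)
  have h2 : ∀ i, pderiv i (pderiv i fun y => F (f y)) x =
      deriv (deriv F) (f x) * pderiv i f x ^ 2 + deriv F (f x) * pderiv i (pderiv i f) x := by
    intro i
    rw [pderiv_congr i (h1 i), pderiv_mul i (hF'.fun_comp' x hfd)
      (differentiableAt_pderiv i hf), pderiv_comp i hF' hfd]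
    ring
  have h3 : ∀ i, pderiv i (fun y => F (f y)) x = deriv F (f x) * pderiv i f x :=
    fun i => (h1 i).self_of_nhds
  have hc : ContDiffAt ℝ 2 (fun y => F (f y)) x := hF.comp x hf
  rw [hyperbolicLaplacian_eq hc, hyperbolicLaplacian_eq hf]
  simp only [h2, h3, Finset.sum_add_distrib, ← Finset.mul_sum]
  have : ∑ i, x i * (deriv F (f x) * pderiv i f x) = deriv F (f x) * ∑ i, x i * pderiv i f x := by
    rw [Finset.mul_sum]; exact Finset.sum_congr rfl fun i _ => by ring
  rw [this]
  ring

theorem hasFDerivAt_norm_sub_sq (a x : EuclideanSpace ℝ (Fin n)) :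
    HasFDerivAt (fun y => ‖y - a‖ ^ 2) (2 • innerSL ℝ (x - a)) x := by
  have := ((hasFDerivAt_id x).sub_const a).norm_sq
  simpa using this

theorem pderiv_norm_sub_sq (i : Fin n) (a x : EuclideanSpace ℝ (Fin n)) :
    pderiv i (fun y => ‖y - a‖ ^ 2) x = 2 * (x i - a i) := by
  rw [pderiv, (hasFDerivAt_norm_sub_sq a x).fderiv]
  simp [EuclideanSpace.inner_single_right]

theorem pderiv_coord (i : Fin n) (x : EuclideanSpace ℝ (Fin n)) :
    pderiv i (fun y => y i) x = 1 := by
  have : HasFDerivAt (fun y : EuclideanSpace ℝ (Fin n) => y i)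
    (EuclideanSpace.proj (𝕜 := ℝ) i) x := (EuclideanSpace.proj (𝕜 := ℝ) i).hasFDerivAt
  rw [pderiv, this.fderiv]
  simp

theorem contDiff_norm_sub_sq (a : EuclideanSpace ℝ (Fin n)) {m : WithTop ℕ∞} :
    ContDiff ℝ m (fun y => ‖y - a‖ ^ 2) :=
  (contDiff_id.sub contDiff_const).norm_sq ℝ

theorem pderiv_affine {f : EuclideanSpace ℝ (Fin n) → ℝ} {x : EuclideanSpace ℝ (Fin n)}
    (i : Fin n) (hf : DifferentiableAt ℝ f x) (b c : ℝ) :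
    pderiv i (fun y => c * f y + b) x = c * pderiv i f x := by
  rw [pderiv, fderiv_add_const, fderiv_const_mul hf]
  simp [pderiv]

theorem differentiableAt_coord (i : Fin n) (x : EuclideanSpace ℝ (Fin n)) :
    DifferentiableAt ℝ (fun y : EuclideanSpace ℝ (Fin n) => y i) x :=
  (EuclideanSpace.proj (𝕜 := ℝ) i).differentiableAt

theorem sum_coord_sq (x : EuclideanSpace ℝ (Fin n)) : ∑ i, x i ^ 2 = ‖x‖ ^ 2 := by
  rw [EuclideanSpace.norm_sq_eq]; simp

theorem sum_coord_mul_sub (a x : EuclideanSpace ℝ (Fin n)) :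
    ∑ i, x i * (x i - a i) = (‖x - a‖ ^ 2 + ‖x‖ ^ 2 - ‖a‖ ^ 2) / 2 := by
  rw [← sum_coord_sq, ← sum_coord_sq, ← sum_coord_sq, ← Finset.sum_add_distrib,
    ← Finset.sum_sub_distrib, Finset.sum_div]
  refine Finset.sum_congr rfl fun i _ => ?_
  simp only [PiLp.sub_apply]
  ring

theorem sum_coord_sub_sq (a x : EuclideanSpace ℝ (Fin n)) :
    ∑ i, (x i - a i) ^ 2 = ‖x - a‖ ^ 2 := by
  rw [← sum_coord_sq]; simp

theorem pderiv_pderiv_norm_sub_sq (i : Fin n) (a x : EuclideanSpace ℝ (Fin n)) :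
    pderiv i (pderiv i fun y => ‖y - a‖ ^ 2) x = 2 := by
  have : (pderiv i fun y => ‖y - a‖ ^ 2) = fun y => 2 * y i + (-(2 * a i)) := by
    ext y; rw [pderiv_norm_sub_sq]; ring
  rw [this, pderiv_affine i (differentiableAt_coord i x), pderiv_coord]
  ring

/-- The hyperbolic Laplacian of `|x - a|²`. -/
theorem hyperbolicLaplacian_norm_sub_sq (a x : EuclideanSpace ℝ (Fin n)) :
    hyperbolicLaplacian (fun y => ‖y - a‖ ^ 2) x = 2 * n * (1 - ‖x‖ ^ 2) ^ 2 +
      2 * ((n : ℝ) - 2) * (1 - ‖x‖ ^ 2) * (‖x - a‖ ^ 2 + ‖x‖ ^ 2 - ‖a‖ ^ 2) := by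
  rw [hyperbolicLaplacian_eq (contDiff_norm_sub_sq a).contDiffAt]
  simp only [pderiv_pderiv_norm_sub_sq, pderiv_norm_sub_sq]
  have : ∑ i, x i * (2 * (x i - a i)) = 2 * ∑ i, x i * (x i - a i) := by
    rw [Finset.mul_sum]; exact Finset.sum_congr rfl fun i _ => by ring
  rw [this, sum_coord_mul_sub]
  simp
  ring

/-- The function `sinh² (d / 2)`, where `d` is the hyperbolic distance between `a` and `x`. -/
noncomputable def hypS (a x : EuclideanSpace ℝ (Fin n)) : ℝ :=
  ‖x - a‖ ^ 2 / ((1 - ‖a‖ ^ 2) * (1 - ‖x‖ ^ 2))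

theorem one_sub_norm_sq_pos {x : EuclideanSpace ℝ (Fin n)} (hx : x ∈ ball 0 1) :
    0 < 1 - ‖x‖ ^ 2 := by
  have : ‖x‖ < 1 := by simpa using hx
  nlinarith [norm_nonneg x]

theorem contDiff_one_sub_norm_sq {m : WithTop ℕ∞} :
    ContDiff ℝ m (fun y : EuclideanSpace ℝ (Fin n) => 1 - ‖y‖ ^ 2) :=
  contDiff_const.sub (contDiff_id.norm_sq ℝ)

theorem contDiffAt_hypS {a x : EuclideanSpace ℝ (Fin n)} (ha : a ∈ ball 0 1) (hx : x ∈ ball 0 1)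
    {m : WithTop ℕ∞} : ContDiffAt ℝ m (hypS a) x := by
  refine (contDiff_norm_sub_sq a).contDiffAt.div
    (contDiff_const.mul contDiff_one_sub_norm_sq).contDiffAt ?_
  exact (mul_pos (one_sub_norm_sq_pos ha) (one_sub_norm_sq_pos hx)).ne'

theorem pderiv_one_sub_norm_sq (i : Fin n) (x : EuclideanSpace ℝ (Fin n)) :
    pderiv i (fun y => 1 - ‖y‖ ^ 2) x = -2 * x i := by
  have : (fun y : EuclideanSpace ℝ (Fin n) => 1 - ‖y‖ ^ 2) =
      fun y => (-1) * ‖y - 0‖ ^ 2 + 1 := by ext y; simp; ring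
  rw [this, pderiv_affine i ((contDiff_norm_sub_sq (m := 1) 0).differentiable (by norm_num) x),
    pderiv_norm_sub_sq]
  simp

theorem hyperbolicLaplacian_one_sub_norm_sq (x : EuclideanSpace ℝ (Fin n)) :
    hyperbolicLaplacian (fun y => 1 - ‖y‖ ^ 2) x = -(2 * n * (1 - ‖x‖ ^ 2) ^ 2 +
      4 * ((n : ℝ) - 2) * (1 - ‖x‖ ^ 2) * ‖x‖ ^ 2) := by
  have : (fun y : EuclideanSpace ℝ (Fin n) => 1 - ‖y‖ ^ 2) =
      fun y => 1 + (-1) * ‖y - 0‖ ^ 2 := by ext y; simp; ring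
  rw [this, hyperbolicLaplacian_add contDiffAt_const
    (contDiffAt_const.mul (contDiff_norm_sub_sq 0).contDiffAt),
    hyperbolicLaplacian_const_mul (contDiff_norm_sub_sq 0).contDiffAt,
    hyperbolicLaplacian_norm_sub_sq, hyperbolicLaplacian_const]
  simp
  ring

theorem pderiv_inv {f : EuclideanSpace ℝ (Fin n) → ℝ} {x : EuclideanSpace ℝ (Fin n)}
    (i : Fin n) (hf : DifferentiableAt ℝ f x) (h0 : f x ≠ 0) :
    pderiv i (fun y => (f y)⁻¹) x = -pderiv i f x / f x ^ 2 := by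
  rw [pderiv_comp (F := fun t => t⁻¹) i (differentiableAt_inv h0) hf]
  simp
  ring

theorem pderiv_hypS (a : EuclideanSpace ℝ (Fin n)) {x : EuclideanSpace ℝ (Fin n)} (i : Fin n)
    (hx : x ∈ ball 0 1) :
    pderiv i (hypS a) x = (1 - ‖a‖ ^ 2)⁻¹ * ((2 * (x i - a i) * (1 - ‖x‖ ^ 2) +
      2 * x i * ‖x - a‖ ^ 2) * ((1 - ‖x‖ ^ 2) ^ 2)⁻¹) := by
  have hρ := one_sub_norm_sq_pos hx
  have hd : DifferentiableAt ℝ (fun y : EuclideanSpace ℝ (Fin n) => 1 - ‖y‖ ^ 2) x :=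
    (contDiff_one_sub_norm_sq (m := 1)).differentiable (by norm_num) x
  have hq : DifferentiableAt ℝ (fun y : EuclideanSpace ℝ (Fin n) => ‖y - a‖ ^ 2) x :=
    (contDiff_norm_sub_sq (m := 1) a).differentiable (by norm_num) x
  have : hypS a = fun y => (1 - ‖a‖ ^ 2)⁻¹ * (‖y - a‖ ^ 2 * (1 - ‖y‖ ^ 2)⁻¹) + 0 := by
    ext y; rw [hypS]; field_simp; simp
  rw [this, pderiv_affine i (hq.fun_mul (hd.fun_inv hρ.ne')), pderiv_mul i hq (hd.fun_inv hρ.ne'),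
    pderiv_inv i hd hρ.ne', pderiv_one_sub_norm_sq, pderiv_norm_sub_sq]
  field_simp
  ring

/-- The invariant gradient and, in the next theorem, the invariant Laplacian of `hypS a` depend on
`x` only through `hypS a x`. This is Möbius invariance, verified here by direct computation. -/
theorem gradient_sq_hypS {a x : EuclideanSpace ℝ (Fin n)} (ha : a ∈ ball 0 1)
    (hx : x ∈ ball 0 1) :
    (1 - ‖x‖ ^ 2) ^ 2 * ∑ i, pderiv i (hypS a) x ^ 2 = 4 * (hypS a x * (1 + hypS a x)) := by
  have hρ := one_sub_norm_sq_pos hx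
  have hρa := one_sub_norm_sq_pos ha
  have h1 : ∀ i, pderiv i (hypS a) x ^ 2 =
      4 * ((1 - ‖a‖ ^ 2)⁻¹ ^ 2 * ((1 - ‖x‖ ^ 2) ^ 2)⁻¹ ^ 2) * ((1 - ‖x‖ ^ 2) ^ 2 * (x i - a i) ^ 2 +
      (2 * (1 - ‖x‖ ^ 2) * ‖x - a‖ ^ 2) * (x i * (x i - a i)) + (‖x - a‖ ^ 2) ^ 2 * x i ^ 2) := by
    intro i; rw [pderiv_hypS a i hx]; ring
  simp only [h1, ← Finset.mul_sum, Finset.sum_add_distrib]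
  rw [sum_coord_sub_sq, sum_coord_mul_sub, sum_coord_sq, hypS]
  have e : ‖x‖ ^ 2 = 1 - (1 - ‖x‖ ^ 2) := by ring
  have e' : ‖a‖ ^ 2 = 1 - (1 - ‖a‖ ^ 2) := by ring
  generalize 1 - ‖x‖ ^ 2 = r at *
  generalize 1 - ‖a‖ ^ 2 = t at *
  rw [e, e']
  field_simp
  ring

theorem hyperbolicLaplacian_hypS {a x : EuclideanSpace ℝ (Fin n)} (ha : a ∈ ball 0 1)
    (hx : x ∈ ball 0 1) :
    hyperbolicLaplacian (hypS a) x = 2 * n * (1 + 2 * hypS a x) := by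
  have hρ := one_sub_norm_sq_pos hx
  have hρa := one_sub_norm_sq_pos ha
  have hd : DifferentiableAt ℝ (fun y : EuclideanSpace ℝ (Fin n) => 1 - ‖y‖ ^ 2) x :=
    (contDiff_one_sub_norm_sq (m := 1)).differentiable (by norm_num) x
  have hd2 : DifferentiableAt ℝ (fun y : EuclideanSpace ℝ (Fin n) => (1 - ‖y‖ ^ 2) ^ 2) x :=
    hd.pow 2
  have hq : DifferentiableAt ℝ (fun y : EuclideanSpace ℝ (Fin n) => ‖y - a‖ ^ 2) x :=
    (contDiff_norm_sub_sq (m := 1) a).differentiable (by norm_num) x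
  -- The radial part `x i * pderiv i` is kept unexpanded so that it merges with the first-order term
  -- of the operator after summation.
  have h2 : ∀ i, pderiv i (pderiv i (hypS a)) x =
      2 * (1 - ‖x‖ ^ 2 + ‖x - a‖ ^ 2) * ((1 - ‖a‖ ^ 2)⁻¹ * ((1 - ‖x‖ ^ 2) ^ 2)⁻¹) +
        4 * (1 - ‖x‖ ^ 2)⁻¹ * (x i * pderiv i (hypS a) x) := by
    intro i
    have hev : pderiv i (hypS a) =ᶠ[𝓝 x] fun y => (1 - ‖a‖ ^ 2)⁻¹ *
        ((2 * (y i + -a i) * (1 - ‖y‖ ^ 2) + 2 * y i * ‖y - a‖ ^ 2) *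
          ((1 - ‖y‖ ^ 2) ^ 2)⁻¹) + 0 := by
      filter_upwards [isOpen_ball.mem_nhds hx] with y hy
      rw [pderiv_hypS a i hy]; ring
    have hc := differentiableAt_coord i x
    have hc' : DifferentiableAt ℝ
        (fun y : EuclideanSpace ℝ (Fin n) => 2 * (y i + -a i)) x :=
      (hc.add_const _).const_mul _
    have hc2 : DifferentiableAt ℝ (fun y : EuclideanSpace ℝ (Fin n) => 2 * y i) x :=
      hc.const_mul _
    have e1 : pderiv i (fun y => 2 * (y i + -a i)) x = 2 := by
      have := pderiv_affine i hc (2 * -a i) 2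
      rw [pderiv_coord] at this
      simpa [mul_add] using this
    have e2 : pderiv i (fun y => 2 * y i) x = 2 := by
      have := pderiv_affine i hc 0 2
      rw [pderiv_coord] at this
      simpa using this
    have e3 : pderiv i (fun y => (1 - ‖y‖ ^ 2) ^ 2) x = -4 * x i * (1 - ‖x‖ ^ 2) := by
      have := pderiv_mul i hd hd
      rw [pderiv_one_sub_norm_sq] at this
      calc _ = pderiv i (fun y => (1 - ‖y‖ ^ 2) * (1 - ‖y‖ ^ 2)) x := by
            congr 1; ext y; ring
        _ = _ := by rw [this]; ring
    have e4 : pderiv i (fun y => 2 * (y i + -a i) * (1 - ‖y‖ ^ 2) + 2 * y i * ‖y - a‖ ^ 2) x =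
        2 * (1 - ‖x‖ ^ 2) + 2 * ‖x - a‖ ^ 2 := by
      have hsum : pderiv i
          (fun y => 2 * (y i + -a i) * (1 - ‖y‖ ^ 2) + 2 * y i * ‖y - a‖ ^ 2) x =
          pderiv i (fun y => 2 * (y i + -a i) * (1 - ‖y‖ ^ 2)) x +
          pderiv i (fun y => 2 * y i * ‖y - a‖ ^ 2) x := by
        rw [pderiv, fderiv_fun_add (hc'.fun_mul hd) (hc2.fun_mul hq)]; rfl
      rw [hsum, pderiv_mul i hc' hd, pderiv_mul i hc2 hq, e1, e2, pderiv_one_sub_norm_sq,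
        pderiv_norm_sub_sq]
      ring
    have hN : DifferentiableAt ℝ (fun y : EuclideanSpace ℝ (Fin n) =>
        2 * (y i + -a i) * (1 - ‖y‖ ^ 2) + 2 * y i * ‖y - a‖ ^ 2) x :=
      (hc'.mul hd).add (hc2.mul hq)
    have h0 : (1 - ‖x‖ ^ 2) ^ 2 ≠ 0 := by positivity
    rw [pderiv_congr i hev, pderiv_affine i (hN.fun_mul (hd2.fun_inv h0)),
      pderiv_mul i hN (hd2.fun_inv h0), pderiv_inv i hd2 h0, e3, e4, pderiv_hypS a i hx]
    field_simp
    ring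
  have h1 : ∑ i, x i * pderiv i (hypS a) x = (1 - ‖a‖ ^ 2)⁻¹ * ((1 - ‖x‖ ^ 2) ^ 2)⁻¹ *
      ((‖x - a‖ ^ 2 + ‖x‖ ^ 2 - ‖a‖ ^ 2) * (1 - ‖x‖ ^ 2) + 2 * ‖x‖ ^ 2 * ‖x - a‖ ^ 2) := by
    have : ∀ i, x i * pderiv i (hypS a) x = (1 - ‖a‖ ^ 2)⁻¹ * ((1 - ‖x‖ ^ 2) ^ 2)⁻¹ *
        (2 * (1 - ‖x‖ ^ 2) * (x i * (x i - a i)) + 2 * ‖x - a‖ ^ 2 * x i ^ 2) := by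
      intro i; rw [pderiv_hypS a i hx]; ring
    simp only [this, ← Finset.mul_sum, Finset.sum_add_distrib]
    rw [sum_coord_mul_sub, sum_coord_sq]
    ring
  rw [hyperbolicLaplacian_eq (contDiffAt_hypS ha hx)]
  simp only [h2, Finset.sum_add_distrib, ← Finset.mul_sum, Finset.sum_const, Finset.card_univ,
    Fintype.card_fin, nsmul_eq_mul]
  rw [h1, hypS]
  have e : ‖x‖ ^ 2 = 1 - (1 - ‖x‖ ^ 2) := by ring
  have e' : ‖a‖ ^ 2 = 1 - (1 - ‖a‖ ^ 2) := by ring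
  generalize 1 - ‖x‖ ^ 2 = r at *
  generalize 1 - ‖a‖ ^ 2 = t at *
  rw [e, e']
  field_simp
  ring

end

/-! ### The invariant measure and Green's identity. -/

section

variable {n : ℕ}

theorem contDiffAt_of_ball {u : EuclideanSpace ℝ (Fin n) → ℝ} {m : WithTop ℕ∞}
    (hu : ContDiffOn ℝ m u (ball 0 1)) {x : EuclideanSpace ℝ (Fin n)} (hx : x ∈ ball 0 1) :
    ContDiffAt ℝ m u x :=
  hu.contDiffAt (isOpen_ball.mem_nhds hx)

theorem continuousOn_hyperbolicLaplacian {u : EuclideanSpace ℝ (Fin n) → ℝ}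
    (hu : ContDiffOn ℝ 2 u (ball 0 1)) : ContinuousOn (hyperbolicLaplacian u) (ball 0 1) := by
  have h1 : ∀ i : Fin n, ContDiffOn ℝ 1 (pderiv i u) (ball 0 1) := fun i x hx =>
    (contDiffAt_pderiv i (contDiffAt_of_ball hu hx)).contDiffWithinAt
  have h2 : ∀ i : Fin n, ContinuousOn (pderiv i (pderiv i u)) (ball 0 1) := fun i x hx => by
    have := ((contDiffAt_of_ball (h1 i) hx).fderiv_right (m := 0) (by norm_num)).clm_apply
      (contDiffAt_const (c := EuclideanSpace.single i (1 : ℝ)))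
    exact this.continuousAt.continuousWithinAt
  have h3 : ∀ i : Fin n, ContinuousOn (pderiv i u) (ball 0 1) := fun i => (h1 i).continuousOn
  have : ContinuousOn (fun x => (1 - ‖x‖ ^ 2) ^ 2 * ∑ i, pderiv i (pderiv i u) x +
      2 * ((n : ℝ) - 2) * (1 - ‖x‖ ^ 2) * ∑ i, x i * pderiv i u x) (ball 0 1) := by
    have hc : ∀ i : Fin n, ContinuousOn (fun x : EuclideanSpace ℝ (Fin n) => x i) (ball 0 1) :=
      fun i => by fun_prop
    refine ContinuousOn.add (ContinuousOn.mul (by fun_prop) ?_)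
      (ContinuousOn.mul (by fun_prop) ?_)
    · exact continuousOn_finsetSum _ fun i _ => h2 i
    · exact continuousOn_finsetSum _ fun i _ => (hc i).mul (h3 i)
  exact this.congr fun x hx => hyperbolicLaplacian_eq (contDiffAt_of_ball hu hx)

/-- The density of the invariant measure of the ball. -/
noncomputable def invDensity (x : EuclideanSpace ℝ (Fin n)) : ℝ := ((1 - ‖x‖ ^ 2) ^ n)⁻¹

/-- The Möbius invariant measure `(1 - |x|²)⁻ⁿ dx` of the unit ball. -/
noncomputable def invMeasure (n : ℕ) : Measure (EuclideanSpace ℝ (Fin n)) :=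
  (volume.restrict (ball 0 1)).withDensity fun x => ENNReal.ofReal (invDensity x)

theorem invDensity_pos {x : EuclideanSpace ℝ (Fin n)} (hx : x ∈ ball 0 1) : 0 < invDensity x :=
  inv_pos.2 (pow_pos (one_sub_norm_sq_pos hx) n)

theorem measurable_invDensity : Measurable (invDensity (n := n)) := by
  unfold invDensity; fun_prop

theorem continuousOn_invDensity : ContinuousOn (invDensity (n := n)) (ball 0 1) := by
  refine ContinuousOn.inv₀ (by fun_prop) fun x hx => ?_
  exact (pow_pos (one_sub_norm_sq_pos hx) n).ne'

theorem integral_invMeasure (f : EuclideanSpace ℝ (Fin n) → ℝ) :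
    ∫ x, f x ∂invMeasure n = ∫ x in ball 0 1, invDensity x * f x := by
  rw [invMeasure, integral_withDensity_eq_integral_toReal_smul
    measurable_invDensity.ennreal_ofReal (by simp)]
  refine setIntegral_congr_fun measurableSet_ball fun x hx => ?_
  simp [ENNReal.toReal_ofReal (invDensity_pos hx).le]

theorem integrable_invMeasure_iff {f : EuclideanSpace ℝ (Fin n) → ℝ} :
    Integrable f (invMeasure n) ↔ IntegrableOn (fun x => invDensity x * f x) (ball 0 1) := by
  rw [invMeasure, integrable_withDensity_iff_integrable_smul'
    measurable_invDensity.ennreal_ofReal (by simp)]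
  refine integrableOn_congr_fun (fun x hx => ?_) measurableSet_ball
  simp [ENNReal.toReal_ofReal (invDensity_pos hx).le]

theorem ae_invMeasure_of_ball {P : EuclideanSpace ℝ (Fin n) → Prop}
    (h : ∀ x ∈ ball (0 : EuclideanSpace ℝ (Fin n)) 1, P x) : ∀ᵐ x ∂invMeasure n, P x :=
  (withDensity_absolutelyContinuous _ _).ae_le
    ((ae_restrict_iff' measurableSet_ball).2 (Eventually.of_forall h))

/-- Extension by zero lets integration by parts take place on the whole space, with no boundary
terms on the sphere. -/
theorem contDiff_indicator_ball {f : EuclideanSpace ℝ (Fin n) → ℝ} {m : WithTop ℕ∞}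
    (hf : ContDiffOn ℝ m f (ball 0 1)) {K : Set (EuclideanSpace ℝ (Fin n))} (hK : IsCompact K)
    (hKb : K ⊆ ball 0 1) (hfK : ∀ x ∈ ball 0 1, x ∉ K → f x = 0) :
    ContDiff ℝ m ((ball 0 1).indicator f) := by
  rw [contDiff_iff_contDiffAt]
  intro x
  by_cases hx : x ∈ K
  · refine (contDiffAt_of_ball hf (hKb hx)).congr_of_eventuallyEq ?_
    filter_upwards [isOpen_ball.mem_nhds (hKb hx)] with y hy
    exact indicator_of_mem hy f
  · refine contDiffAt_const (c := (0 : ℝ)) |>.congr_of_eventuallyEq ?_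
    filter_upwards [hK.isClosed.isOpen_compl.mem_nhds hx] with y hy
    by_cases hyb : y ∈ ball (0 : EuclideanSpace ℝ (Fin n)) 1
    · rw [indicator_of_mem hyb, hfK y hyb hy]
    · exact indicator_of_notMem hyb f

theorem hasCompactSupport_indicator_ball {f : EuclideanSpace ℝ (Fin n) → ℝ}
    {K : Set (EuclideanSpace ℝ (Fin n))} (hK : IsCompact K)
    (hfK : ∀ x ∈ ball 0 1, x ∉ K → f x = 0) : HasCompactSupport ((ball 0 1).indicator f) := by
  refine HasCompactSupport.intro hK fun x hx => ?_
  by_cases hxb : x ∈ ball (0 : EuclideanSpace ℝ (Fin n)) 1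
  · rw [indicator_of_mem hxb, hfK x hxb hx]
  · exact indicator_of_notMem hxb f

theorem integrableOn_ball_of_compact {f : EuclideanSpace ℝ (Fin n) → ℝ}
    (hf : ContinuousOn f (ball 0 1)) {K : Set (EuclideanSpace ℝ (Fin n))} (hK : IsCompact K)
    (hKb : K ⊆ ball 0 1) (hfK : ∀ x ∈ ball 0 1, x ∉ K → f x = 0) :
    IntegrableOn f (ball 0 1) := by
  rw [← integrable_indicator_iff measurableSet_ball]
  exact ((contDiff_indicator_ball (contDiffOn_zero.2 hf) hK hKb hfK).continuous
    (𝕜 := ℝ)).integrable_of_hasCompactSupport (hasCompactSupport_indicator_ball hK hfK)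

theorem integrable_invMeasure_of_compact {f : EuclideanSpace ℝ (Fin n) → ℝ}
    (hf : ContinuousOn f (ball 0 1)) {K : Set (EuclideanSpace ℝ (Fin n))} (hK : IsCompact K)
    (hKb : K ⊆ ball 0 1) (hfK : ∀ x ∈ ball 0 1, x ∉ K → f x = 0) :
    Integrable f (invMeasure n) := by
  rw [integrable_invMeasure_iff]
  refine integrableOn_ball_of_compact (continuousOn_invDensity.mul hf) hK hKb fun x hx hxK => ?_
  rw [hfK x hx hxK, mul_zero]

theorem integral_pderiv_eq_zero {V : EuclideanSpace ℝ (Fin n) → ℝ} (hV : ContDiff ℝ 1 V)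
    (hc : HasCompactSupport V) (i : Fin n) :
    ∫ x, pderiv i V x = 0 ∧ Integrable (pderiv i V) := by
  have hcont : Continuous (pderiv i V) :=
    (hV.continuous_fderiv (by norm_num)).clm_apply continuous_const
  have hc' : HasCompactSupport (pderiv i V) := hc.fderiv_apply ℝ _
  have hint := hcont.integrable_of_hasCompactSupport (μ := volume) hc'
  refine ⟨?_, hint⟩
  have := integral_mul_fderiv_eq_neg_fderiv_mul_of_integrable (μ := volume) (𝕜 := ℝ)
    (f := fun _ : EuclideanSpace ℝ (Fin n) => (1 : ℝ)) (g := V) (v := EuclideanSpace.single i 1)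
    (by simp) (by simp only [one_mul]; exact hint)
    (by simpa using hV.continuous.integrable_of_hasCompactSupport hc)
    (fun x _ => differentiableAt_const _) (fun x _ => hV.differentiable (by norm_num) x)
  simpa [pderiv] using this

/-- This is the divergence form `Δ_h = ρⁿ div(ρ²⁻ⁿ ∇)`: the terms in `∇u · ∇v` cancel, and
differentiating the weight `ρ²⁻ⁿ` produces the first-order term of `Δ_h`. -/
theorem sum_pderiv_wronskian (hn : 2 ≤ n) {u v : EuclideanSpace ℝ (Fin n) → ℝ}
    {x : EuclideanSpace ℝ (Fin n)} (hu : ContDiffAt ℝ 2 u x) (hv : ContDiffAt ℝ 2 v x)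
    (hx : x ∈ ball 0 1) :
    ∑ i, pderiv i (fun y => ((1 - ‖y‖ ^ 2) ^ (n - 2))⁻¹ *
      (v y * pderiv i u y + (-1) * (u y * pderiv i v y))) x =
    invDensity x * (v x * hyperbolicLaplacian u x - u x * hyperbolicLaplacian v x) := by
  obtain ⟨k, rfl⟩ := Nat.exists_eq_add_of_le' hn
  simp only [Nat.add_sub_cancel]
  have hρ := one_sub_norm_sq_pos hx
  have hd : DifferentiableAt ℝ (fun y : EuclideanSpace ℝ (Fin (k + 2)) => 1 - ‖y‖ ^ 2) x :=
    (contDiff_one_sub_norm_sq (m := 1)).differentiable (by norm_num) x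
  have hdk : DifferentiableAt ℝ
      (fun y : EuclideanSpace ℝ (Fin (k + 2)) => (1 - ‖y‖ ^ 2) ^ k) x := hd.fun_pow k
  have hk0 : (1 - ‖x‖ ^ 2) ^ k ≠ 0 := (pow_pos hρ k).ne'
  have hud := hu.differentiableAt (n := 2) (by norm_num)
  have hvd := hv.differentiableAt (n := 2) (by norm_num)
  have hω : ∀ i, pderiv i (fun y : EuclideanSpace ℝ (Fin (k + 2)) => ((1 - ‖y‖ ^ 2) ^ k)⁻¹) x =
      2 * k * x i * ((1 - ‖x‖ ^ 2) ^ (k + 1))⁻¹ := by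
    intro i
    rw [pderiv_inv i hdk hk0, pderiv_comp (F := fun t => t ^ k) i (by fun_prop) hd,
      pderiv_one_sub_norm_sq]
    rcases k with _ | k
    · simp
    · simp
      field_simp
      ring
  have h : ∀ i, pderiv i (fun y => ((1 - ‖y‖ ^ 2) ^ k)⁻¹ *
      (v y * pderiv i u y + (-1) * (u y * pderiv i v y))) x =
      ((1 - ‖x‖ ^ 2) ^ k)⁻¹ * (v x * pderiv i (pderiv i u) x - u x * pderiv i (pderiv i v) x) +
      2 * k * ((1 - ‖x‖ ^ 2) ^ (k + 1))⁻¹ *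
        (v x * (x i * pderiv i u x) - u x * (x i * pderiv i v x)) := by
    intro i
    have hui := differentiableAt_pderiv i hu
    have hvi := differentiableAt_pderiv i hv
    have hsum : pderiv i (fun y => v y * pderiv i u y + (-1) * (u y * pderiv i v y)) x =
        pderiv i (fun y => v y * pderiv i u y) x +
          (-1) * pderiv i (fun y => u y * pderiv i v y) x := by
      rw [pderiv, fderiv_fun_add (hvd.fun_mul hui) ((hud.fun_mul hvi).const_mul _),
        fderiv_const_mul (hud.fun_mul hvi)]
      rfl
    rw [pderiv_mul i (hdk.fun_inv hk0)
      ((hvd.fun_mul hui).fun_add ((hud.fun_mul hvi).const_mul _)), hsum, pderiv_mul i hvd hui,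
      pderiv_mul i hud hvi, hω]
    ring
  simp only [h, Finset.sum_add_distrib, ← Finset.mul_sum, Finset.sum_sub_distrib]
  rw [hyperbolicLaplacian_eq hu, hyperbolicLaplacian_eq hv, invDensity]
  push_cast
  field_simp
  ring

/-- **Green's identity** for the hyperbolic Laplacian. -/
theorem green (hn : 2 ≤ n) {u v : EuclideanSpace ℝ (Fin n) → ℝ}
    (hu : ContDiffOn ℝ 2 u (ball 0 1)) (hv : ContDiffOn ℝ 2 v (ball 0 1))
    {K : Set (EuclideanSpace ℝ (Fin n))} (hK : IsCompact K) (hKb : K ⊆ ball 0 1)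
    (hvK : ∀ x ∈ ball 0 1, x ∉ K → v x = 0) :
    ∫ x, v x * hyperbolicLaplacian u x ∂invMeasure n =
      ∫ x, u x * hyperbolicLaplacian v x ∂invMeasure n := by
  have hvK' : ∀ x ∈ ball 0 1, x ∉ K → v =ᶠ[𝓝 x] fun _ => 0 := by
    intro x hx hxK
    filter_upwards [isOpen_ball.mem_nhds hx, hK.isClosed.isOpen_compl.mem_nhds hxK] with y h1 h2
    exact hvK y h1 h2
  have hpd : ∀ i, ∀ x ∈ ball 0 1, x ∉ K → pderiv i v x = 0 := by
    intro i x hx hxK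
    rw [pderiv_congr i (hvK' x hx hxK)]
    simp [pderiv]
  have hhl : ∀ x ∈ ball 0 1, x ∉ K → hyperbolicLaplacian v x = 0 := by
    intro x hx hxK
    have h1 := InnerProductSpace.laplacian_congr_nhds (hvK' x hx hxK)
    have h2 := (hvK' x hx hxK).fderiv_eq (𝕜 := ℝ)
    simp only [hyperbolicLaplacian, h1.self_of_nhds, h2]
    have h3 := hyperbolicLaplacian_const 0 x
    exact h3
  let W : Fin n → EuclideanSpace ℝ (Fin n) → ℝ := fun i y =>
    ((1 - ‖y‖ ^ 2) ^ (n - 2))⁻¹ * (v y * pderiv i u y + (-1) * (u y * pderiv i v y))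
  have hpC : ∀ {w : EuclideanSpace ℝ (Fin n) → ℝ} (_ : ContDiffOn ℝ 2 w (ball 0 1)) (i : Fin n),
      ContDiffOn ℝ 1 (pderiv i w) (ball 0 1) := fun hw i x hx =>
    (contDiffAt_pderiv i (contDiffAt_of_ball hw hx)).contDiffWithinAt
  have hW : ∀ i, ContDiffOn ℝ 1 (W i) (ball 0 1) := by
    intro i
    have hu1 := hu.of_le (m := 1) (by norm_num)
    have hv1 := hv.of_le (m := 1) (by norm_num)
    refine ContDiffOn.mul (ContDiffOn.inv (contDiff_one_sub_norm_sq.pow _).contDiffOn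
      fun x hx => (pow_pos (one_sub_norm_sq_pos hx) _).ne') ?_
    exact (hv1.mul (hpC hu i)).add (contDiffOn_const.mul (hu1.mul (hpC hv i)))
  have hWK : ∀ i, ∀ x ∈ ball 0 1, x ∉ K → W i x = 0 := by
    intro i x hx hxK
    simp only [W, hvK x hx hxK, hpd i x hx hxK]
    ring
  have hV := fun i => integral_pderiv_eq_zero
    (contDiff_indicator_ball (hW i) hK hKb (hWK i)) (hasCompactSupport_indicator_ball hK (hWK i)) i
  have hsum : ∀ x, ∑ i, pderiv i ((ball 0 1).indicator (W i)) x =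
      (ball 0 1).indicator (fun x => invDensity x * (v x * hyperbolicLaplacian u x -
        u x * hyperbolicLaplacian v x)) x := by
    intro x
    by_cases hx : x ∈ ball (0 : EuclideanSpace ℝ (Fin n)) 1
    · rw [indicator_of_mem hx, ← sum_pderiv_wronskian hn (contDiffAt_of_ball hu hx)
        (contDiffAt_of_ball hv hx) hx]
      refine Finset.sum_congr rfl fun i _ => pderiv_congr i ?_
      filter_upwards [isOpen_ball.mem_nhds hx] with y hy
      rw [indicator_of_mem hy]
    · rw [indicator_of_notMem hx]
      refine Finset.sum_eq_zero fun i _ => ?_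
      have : (ball 0 1).indicator (W i) =ᶠ[𝓝 x] fun _ => 0 := by
        have hxK : x ∉ K := fun h => hx (hKb h)
        filter_upwards [hK.isClosed.isOpen_compl.mem_nhds hxK] with y hy
        by_cases hyb : y ∈ ball (0 : EuclideanSpace ℝ (Fin n)) 1
        · rw [indicator_of_mem hyb, hWK i y hyb hy]
        · exact indicator_of_notMem hyb _
      rw [pderiv_congr i this]
      simp [pderiv]
  have h0 : ∫ x, ∑ i, pderiv i ((ball 0 1).indicator (W i)) x = 0 := by
    rw [integral_finsetSum _ fun i _ => (hV i).2]
    exact Finset.sum_eq_zero fun i _ => (hV i).1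
  simp only [hsum] at h0
  rw [integral_indicator measurableSet_ball, ← integral_invMeasure, integral_sub] at h0
  · linarith
  · refine integrable_invMeasure_of_compact
      (hv.continuousOn.mul (continuousOn_hyperbolicLaplacian hu)) hK hKb fun x hx hxK => ?_
    rw [hvK x hx hxK, zero_mul]
  · refine integrable_invMeasure_of_compact
      (hu.continuousOn.mul (continuousOn_hyperbolicLaplacian hv)) hK hKb fun x hx hxK => ?_
    rw [hhl x hx hxK, mul_zero]

end

/-! ### The radial profiles: regularized Green function and mean value kernel. -/

section

theorem deriv_smoothTransition_nonneg (t : ℝ) : 0 ≤ deriv Real.smoothTransition t :=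
  Real.smoothTransition.monotone.deriv_nonneg

theorem deriv_smoothTransition_of_nonpos {t : ℝ} (ht : t ≤ 0) :
    deriv Real.smoothTransition t = 0 := by
  refine IsLocalMin.deriv_eq_zero (Eventually.of_forall fun s => ?_)
  rw [Real.smoothTransition.zero_of_nonpos ht]
  exact Real.smoothTransition.nonneg s

theorem deriv_smoothTransition_of_one_le {t : ℝ} (ht : 1 ≤ t) :
    deriv Real.smoothTransition t = 0 := by
  refine IsLocalMax.deriv_eq_zero (Eventually.of_forall fun s => ?_)
  rw [Real.smoothTransition.one_of_one_le ht]
  exact Real.smoothTransition.le_one s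

theorem contDiff_deriv_smoothTransition : ContDiff ℝ 1 (deriv Real.smoothTransition) := by
  have : ContDiff ℝ 2 Real.smoothTransition := Real.smoothTransition.contDiff (n := 2)
  have h := (contDiff_succ_iff_deriv (n := 1) (f := Real.smoothTransition)).1
    (by simpa [one_add_one_eq_two] using this)
  exact h.2.2

/-- A smooth step rising from `0` at `ε / 2` to `1` at `ε`. -/
noncomputable def stepFun (ε s : ℝ) : ℝ := Real.smoothTransition (2 * s / ε - 1)

/-- The weight `(s (1 + s)) ^ (n / 2)`. -/
noncomputable def radialWeight (n : ℕ) (s : ℝ) : ℝ := (s * (1 + s)) ^ ((n : ℝ) / 2)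

/-- The negative of the derivative of the regularized radial Green function. -/
noncomputable def greenSlope (n : ℕ) (ε s : ℝ) : ℝ :=
  (stepFun ε s - stepFun (1 / 16) s) / radialWeight n s

/-- The regularized radial Green function, as a function of `sinh² (d / 2)`. -/
noncomputable def greenFun (n : ℕ) (ε s : ℝ) : ℝ := ∫ t in s..1, greenSlope n ε t

/-- The nonnegative radial kernel carried by `ε / 2 ≤ s ≤ ε`. -/
noncomputable def meanKernel (n : ℕ) (ε s : ℝ) : ℝ :=
  4 * (s * (1 + s)) / radialWeight n s * (2 / ε * deriv Real.smoothTransition (2 * s / ε - 1))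

variable {n : ℕ} {ε s : ℝ}

theorem stepFun_of_le (hε : 0 < ε) (hs : s ≤ ε / 2) : stepFun ε s = 0 := by
  refine Real.smoothTransition.zero_of_nonpos ?_
  rw [sub_nonpos, div_le_one hε]
  linarith

theorem stepFun_of_ge (hε : 0 < ε) (hs : ε ≤ s) : stepFun ε s = 1 := by
  refine Real.smoothTransition.one_of_one_le ?_
  rw [le_sub_iff_add_le, le_div_iff₀ hε]
  linarith

theorem stepFun_sub_nonneg (hε : 0 < ε) (hε' : ε ≤ 1 / 16) :
    0 ≤ stepFun ε s - stepFun (1 / 16) s := by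
  rcases le_or_gt s 0 with hs | hs
  · rw [stepFun_of_le hε (by linarith), stepFun_of_le (by norm_num) (by linarith), sub_zero]
  · rw [sub_nonneg]
    refine Real.smoothTransition.monotone ?_
    gcongr

theorem stepFun_sub_le_one : stepFun ε s - stepFun (1 / 16) s ≤ 1 := by
  have h1 : stepFun ε s ≤ 1 := Real.smoothTransition.le_one _
  have h2 : 0 ≤ stepFun (1 / 16) s := Real.smoothTransition.nonneg _
  linarith

theorem contDiff_stepFun {m : ℕ∞} : ContDiff ℝ m (stepFun ε) := by
  refine Real.smoothTransition.contDiff.comp (g := Real.smoothTransition) ?_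
  fun_prop

theorem hasDerivAt_stepFun :
    HasDerivAt (stepFun ε) (2 / ε * deriv Real.smoothTransition (2 * s / ε - 1)) s := by
  have h1 : HasDerivAt (fun s : ℝ => 2 * s / ε - 1) (2 / ε) s := by
    simpa using (((hasDerivAt_id s).const_mul 2).div_const ε).sub_const 1
  have h2 : HasDerivAt Real.smoothTransition (deriv Real.smoothTransition (2 * s / ε - 1))
      (2 * s / ε - 1) :=
    ((Real.smoothTransition.contDiff (n := 1)).differentiable (by norm_num) _).hasDerivAt
  rw [mul_comm]
  exact h2.comp s h1

theorem radialWeight_pos (hs : 0 < s) : 0 < radialWeight n s :=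
  Real.rpow_pos_of_pos (by positivity) _

theorem contDiffAt_radialWeight (hs : 0 < s) {m : WithTop ℕ∞} :
    ContDiffAt ℝ m (radialWeight n) s := by
  refine ContDiffAt.rpow_const_of_ne (f := fun s : ℝ => s * (1 + s)) (by fun_prop) ?_
  positivity

/-- The weight `w` is the integrating factor of the radial operator: `4s(1+s) F'' + 2n(1+2s) F' =
4s(1+s)/w · (w F')'`. Prescribing `w F'` as a difference of steps therefore makes the right side a
difference of bumps. -/
theorem deriv_radialWeight (hs : 0 < s) :
    s * (1 + s) * deriv (radialWeight n) s = n / 2 * (1 + 2 * s) * radialWeight n s := by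
  have h1 : HasDerivAt (fun s : ℝ => s * (1 + s)) (1 + 2 * s) s := by
    have := (hasDerivAt_id s).mul ((hasDerivAt_id s).const_add 1)
    refine this.congr_deriv ?_
    simp; ring
  have hg : 0 < s * (1 + s) := by positivity
  have h2 := h1.rpow_const (p := (n : ℝ) / 2) (Or.inl hg.ne')
  have h3 : deriv (radialWeight n) s = _ := h2.deriv
  rw [h3, radialWeight, Real.rpow_sub_one hg.ne']
  field_simp

theorem pow_le_radialWeight {r : ℝ} (hr : 0 < r) : r ^ n ≤ radialWeight n (r ^ 2) := by
  have : r ^ n = (r ^ 2) ^ ((n : ℝ) / 2) := by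
    rw [← Real.rpow_natCast r 2, ← Real.rpow_mul hr.le, ← Real.rpow_natCast]
    congr 1
    push_cast; ring
  rw [this, radialWeight]
  refine Real.rpow_le_rpow (by positivity) ?_ (by positivity)
  nlinarith [sq_nonneg r, sq_nonneg (r ^ 2)]

theorem radialWeight_le_one (hs : 0 < s) (hs' : s ≤ 1 / 2) : radialWeight n s ≤ 1 :=
  Real.rpow_le_one (by positivity) (by nlinarith) (by positivity)

theorem greenSlope_of_le (hε : 0 < ε) (hε' : ε ≤ 1 / 16) (hs : s ≤ ε / 2) :
    greenSlope n ε s = 0 := by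
  rw [greenSlope, stepFun_of_le hε hs, stepFun_of_le (by norm_num) (by linarith)]
  simp

theorem greenSlope_of_ge (hε : 0 < ε) (hε' : ε ≤ 1 / 16) (hs : 1 / 16 ≤ s) :
    greenSlope n ε s = 0 := by
  rw [greenSlope, stepFun_of_ge hε (by linarith), stepFun_of_ge (by norm_num) hs]
  simp

theorem contDiff_greenSlope (hε : 0 < ε) (hε' : ε ≤ 1 / 16) : ContDiff ℝ 1 (greenSlope n ε) := by
  rw [contDiff_iff_contDiffAt]
  intro s
  rcases le_or_gt s 0 with hs | hs
  · refine contDiffAt_const (c := (0 : ℝ)) |>.congr_of_eventuallyEq ?_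
    filter_upwards [Iio_mem_nhds (show s < ε / 2 by linarith)] with t ht
    exact greenSlope_of_le hε hε' (le_of_lt ht)
  · exact ((contDiff_stepFun (m := 1)).contDiffAt.sub (contDiff_stepFun (m := 1)).contDiffAt).div
      (contDiffAt_radialWeight hs) (radialWeight_pos hs).ne'

theorem greenSlope_nonneg (hε : 0 < ε) (hε' : ε ≤ 1 / 16) : 0 ≤ greenSlope n ε s := by
  rcases le_or_gt s 0 with hs | hs
  · rw [greenSlope_of_le hε hε' (by linarith)]
  · exact div_nonneg (stepFun_sub_nonneg hε hε') (radialWeight_pos hs).le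

theorem greenSlope_sq_le {r : ℝ} (hr : 0 < r) : greenSlope n ε (r ^ 2) ≤ (r ^ n)⁻¹ := by
  rw [greenSlope, div_eq_mul_inv]
  calc _ ≤ 1 * (radialWeight n (r ^ 2))⁻¹ := by
        refine mul_le_mul_of_nonneg_right stepFun_sub_le_one ?_
        exact (inv_pos.2 (radialWeight_pos (by positivity))).le
    _ ≤ (r ^ n)⁻¹ := by
        rw [one_mul]
        exact inv_anti₀ (by positivity) (pow_le_radialWeight hr)

theorem hasDerivAt_greenFun (hε : 0 < ε) (hε' : ε ≤ 1 / 16) :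
    HasDerivAt (greenFun n ε) (-greenSlope n ε s) s := by
  have hc := (contDiff_greenSlope (n := n) hε hε').continuous
  exact intervalIntegral.integral_hasDerivAt_left (hc.intervalIntegrable _ _)
    hc.stronglyMeasurable.stronglyMeasurableAtFilter hc.continuousAt

theorem deriv_greenFun (hε : 0 < ε) (hε' : ε ≤ 1 / 16) :
    deriv (greenFun n ε) = fun s => -greenSlope n ε s :=
  funext fun _ => (hasDerivAt_greenFun hε hε').deriv

theorem contDiff_greenFun (hε : 0 < ε) (hε' : ε ≤ 1 / 16) : ContDiff ℝ 2 (greenFun n ε) := by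
  have : ContDiff ℝ (1 + 1) (greenFun n ε) := by
    refine contDiff_succ_iff_deriv.2 ⟨fun s => (hasDerivAt_greenFun hε hε').differentiableAt,
      by simp, ?_⟩
    rw [deriv_greenFun hε hε']
    exact (contDiff_greenSlope hε hε').neg
  simpa [one_add_one_eq_two] using this

theorem greenFun_antitone (hε : 0 < ε) (hε' : ε ≤ 1 / 16) : Antitone (greenFun n ε) := by
  refine antitone_of_deriv_nonpos ((contDiff_greenFun hε hε').differentiable (by norm_num))
    fun s => ?_
  rw [deriv_greenFun hε hε']
  exact neg_nonpos.2 (greenSlope_nonneg hε hε')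

theorem greenFun_of_ge (hε : 0 < ε) (hε' : ε ≤ 1 / 16) (hs : 1 / 16 ≤ s) :
    greenFun n ε s = 0 := by
  rw [greenFun]
  calc _ = ∫ _ in s..1, (0 : ℝ) := by
        refine intervalIntegral.integral_congr fun t ht => ?_
        refine greenSlope_of_ge hε hε' (le_trans ?_ ht.1)
        exact le_min hs (by norm_num)
    _ = 0 := by simp

theorem greenFun_nonneg (hε : 0 < ε) (hε' : ε ≤ 1 / 16) : 0 ≤ greenFun n ε s := by
  rcases le_or_gt (1 / 16) s with hs | hs
  · rw [greenFun_of_ge hε hε' hs]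
  · rw [← greenFun_of_ge (n := n) hε hε' le_rfl]
    exact greenFun_antitone hε hε' hs.le

/-- Between `1/64` and `1/32` the step at scale `ε` has reached `1` and the one at `1/16` has not
started, so the slope is `1/w ≥ 1` on an interval of length `1/64`. -/
theorem greenFun_lower (hε : 0 < ε) (hε' : ε ≤ 1 / 64) (hs : s ≤ 1 / 64) :
    1 / 64 ≤ greenFun n ε s := by
  have hε2 : ε ≤ 1 / 16 := by linarith
  have h1 := greenFun_antitone (n := n) hε hε2 hs
  refine le_trans ?_ h1
  have h2 := greenFun_nonneg (n := n) (s := 1 / 32) hε hε2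
  have hc := (contDiff_greenSlope (n := n) hε hε2).continuous
  have h3 : greenFun n ε (1 / 64) =
      (∫ t in (1 / 64 : ℝ)..(1 / 32), greenSlope n ε t) + greenFun n ε (1 / 32) :=
    (intervalIntegral.integral_add_adjacent_intervals (hc.intervalIntegrable _ _)
      (hc.intervalIntegrable _ _)).symm
  have h4 : ∫ _ in (1 / 64 : ℝ)..(1 / 32), (1 : ℝ) ≤
      ∫ t in (1 / 64 : ℝ)..(1 / 32), greenSlope n ε t := by
    refine intervalIntegral.integral_mono_on (by norm_num) (by simp)
      (hc.intervalIntegrable _ _) fun t ht => ?_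
    have ht0 : 0 < t := lt_of_lt_of_le (by norm_num) ht.1
    rw [greenSlope, stepFun_of_ge hε (hε'.trans ht.1), stepFun_of_le (by norm_num)
      (ht.2.trans (by norm_num)), sub_zero, le_div_iff₀ (radialWeight_pos ht0), one_mul]
    exact radialWeight_le_one ht0 (ht.2.trans (by norm_num))
  rw [h3]
  norm_num at h4
  linarith

/-- In the variable `√s`, which is comparable to distance, the derivative is at most `2 x · x⁻ⁿ`,
uniformly in `ε`; the mean value inequality does the rest. -/
theorem abs_greenFun_sq_sub_le (hn : 1 ≤ n) (hε : 0 < ε) (hε' : ε ≤ 1 / 16) {r t : ℝ} (hr : 0 < r)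
    (hrt : r ≤ t) :
    |greenFun n ε (t ^ 2) - greenFun n ε (r ^ 2)| ≤ 2 * (r ^ (n - 1))⁻¹ * (t - r) := by
  have hd : ∀ x ∈ Icc r t, HasDerivWithinAt (fun x => greenFun n ε (x ^ 2))
      (-greenSlope n ε (x ^ 2) * (2 * x)) (Icc r t) x := by
    intro x _
    have h1 : HasDerivAt (fun x : ℝ => x ^ 2) (2 * x) x := by simpa using hasDerivAt_pow 2 x
    exact ((hasDerivAt_greenFun hε hε').comp x h1).hasDerivWithinAt
  have hb : ∀ x ∈ Icc r t, ‖-greenSlope n ε (x ^ 2) * (2 * x)‖ ≤ 2 * (r ^ (n - 1))⁻¹ := by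
    intro x hx
    have hx0 : 0 < x := hr.trans_le hx.1
    obtain ⟨k, rfl⟩ := Nat.exists_eq_add_of_le' hn
    rw [Real.norm_eq_abs, abs_mul, abs_neg, abs_of_nonneg (greenSlope_nonneg hε hε'),
      abs_of_pos (by positivity : 0 < 2 * x), Nat.add_sub_cancel]
    calc _ ≤ (x ^ (k + 1))⁻¹ * (2 * x) := by
          gcongr; exact greenSlope_sq_le hx0
      _ = 2 * (x ^ k)⁻¹ := by rw [pow_succ]; field_simp
      _ ≤ 2 * (r ^ k)⁻¹ := by gcongr; exact hx.1
  have := (convex_Icc r t).norm_image_sub_le_of_norm_hasDerivWithin_le hd hb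
    (left_mem_Icc.2 hrt) (right_mem_Icc.2 hrt)
  rwa [Real.norm_eq_abs, Real.norm_eq_abs, abs_of_nonneg (sub_nonneg.2 hrt)] at this

/-- Compare with `r = 1/4`, where the function vanishes. The bound is cruder than the true
singularity for small `r`, but it lets size and gradient share one potential. -/
theorem greenFun_sq_le (hn : 1 ≤ n) (hε : 0 < ε) (hε' : ε ≤ 1 / 16) {r : ℝ} (hr : 0 < r) :
    greenFun n ε (r ^ 2) ≤ (r ^ (n - 1))⁻¹ := by
  have hp : 0 < (r ^ (n - 1))⁻¹ := by positivity
  rcases le_or_gt (1 / 4) r with h | h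
  · rw [greenFun_of_ge hε hε' (by nlinarith)]
    exact hp.le
  · have := abs_greenFun_sq_sub_le hn hε hε' hr h.le
    rw [greenFun_of_ge hε hε' (by norm_num : (1 : ℝ) / 16 ≤ (1 / 4) ^ 2), zero_sub, abs_neg] at this
    refine (le_abs_self _).trans (this.trans ?_)
    nlinarith

theorem meanKernel_of_le (hε : 0 < ε) (hs : s ≤ ε / 2) : meanKernel n ε s = 0 := by
  rw [meanKernel, deriv_smoothTransition_of_nonpos]
  · simp
  · rw [sub_nonpos, div_le_one hε]
    linarith

theorem meanKernel_of_ge (hε : 0 < ε) (hs : ε ≤ s) : meanKernel n ε s = 0 := by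
  rw [meanKernel, deriv_smoothTransition_of_one_le]
  · simp
  · rw [le_sub_iff_add_le, le_div_iff₀ hε]
    linarith

theorem meanKernel_nonneg (hε : 0 < ε) : 0 ≤ meanKernel n ε s := by
  rcases le_or_gt s 0 with hs | hs
  · rw [meanKernel_of_le hε (by linarith)]
  · have := radialWeight_pos (n := n) hs
    have := deriv_smoothTransition_nonneg (2 * s / ε - 1)
    rw [meanKernel]
    positivity

theorem contDiff_meanKernel (hε : 0 < ε) : ContDiff ℝ 1 (meanKernel n ε) := by
  rw [contDiff_iff_contDiffAt]
  intro s
  rcases le_or_gt s 0 with hs | hs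
  · refine contDiffAt_const (c := (0 : ℝ)) |>.congr_of_eventuallyEq ?_
    filter_upwards [Iio_mem_nhds (show s < ε / 2 by linarith)] with t ht
    exact meanKernel_of_le hε (le_of_lt ht)
  · refine ContDiffAt.mul (ContDiffAt.div (by fun_prop) (contDiffAt_radialWeight hs)
      (radialWeight_pos hs).ne') ?_
    refine contDiffAt_const.mul ?_
    exact (contDiff_deriv_smoothTransition.comp (g := deriv Real.smoothTransition)
      (f := fun s : ℝ => 2 * s / ε - 1) (by fun_prop)).contDiffAt

theorem exists_lipschitzWith_meanKernel (hε : 0 < ε) :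
    ∃ C : ℝ≥0, LipschitzWith C (meanKernel n ε) := by
  refine ContDiff.lipschitzWith_of_hasCompactSupport (𝕂 := ℝ) (n := 1) ?_
    (contDiff_meanKernel hε) (by norm_num)
  refine HasCompactSupport.intro (isCompact_Icc (a := 0) (b := ε)) fun s hs => ?_
  by_cases h : s ≤ ε / 2
  · exact meanKernel_of_le hε h
  · refine meanKernel_of_ge hε (not_lt.1 fun h' => hs ⟨?_, h'.le⟩)
    linarith

/-- The radial part of the hyperbolic Laplacian, applied to the regularized Green function. -/
theorem radial_laplacian_greenFun (hε : 0 < ε) (hε' : ε ≤ 1 / 16) (hs : 0 ≤ s) :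
    deriv (deriv (greenFun n ε)) s * (4 * (s * (1 + s))) +
      deriv (greenFun n ε) s * (2 * n * (1 + 2 * s)) =
      meanKernel n (1 / 16) s - meanKernel n ε s := by
  rw [deriv_greenFun hε hε']
  beta_reduce
  rcases hs.eq_or_lt with rfl | hs
  · rw [greenSlope_of_le hε hε' (by linarith), meanKernel_of_le (by norm_num) (by norm_num),
      meanKernel_of_le hε (by linarith)]
    simp
  · have hw := radialWeight_pos (n := n) hs
    have hd := (hasDerivAt_stepFun (ε := ε) (s := s)).fun_sub
      (hasDerivAt_stepFun (ε := 1 / 16) (s := s))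
    have hm : HasDerivAt (radialWeight n) (deriv (radialWeight n) s) s :=
      ((contDiffAt_radialWeight hs (m := 1)).differentiableAt (by norm_num)).hasDerivAt
    have h1 := (hd.fun_div hm hw.ne').fun_neg.deriv
    have h2 := deriv_radialWeight (n := n) hs
    have h3 : deriv (fun s => -greenSlope n ε s) s = _ := h1
    rw [h3, greenSlope, meanKernel, meanKernel]
    generalize deriv (radialWeight n) s = m' at *
    generalize radialWeight n s = m at *
    generalize 2 / ε * deriv Real.smoothTransition (2 * s / ε - 1) = d1 at *
    generalize 2 / (1 / 16) * deriv Real.smoothTransition (2 * s / (1 / 16) - 1) = d2 at *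
    generalize stepFun ε s = f1 at *
    generalize stepFun (1 / 16) s = f2 at *
    field_simp
    linear_combination (4 * (f1 - f2)) * h2

end

/-! ### Hyperbolic balls and the mean value formula. -/

section

variable {n : ℕ} {a x y : EuclideanSpace ℝ (Fin n)}

theorem hypS_nonneg (ha : a ∈ ball 0 1) (hy : y ∈ ball 0 1) : 0 ≤ hypS a y :=
  div_nonneg (sq_nonneg _) (mul_pos (one_sub_norm_sq_pos ha) (one_sub_norm_sq_pos hy)).le

theorem hypS_le_iff (ha : a ∈ ball 0 1) (hy : y ∈ ball 0 1) {t : ℝ} :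
    hypS a y ≤ t ↔ ‖y - a‖ ^ 2 ≤ t * ((1 - ‖a‖ ^ 2) * (1 - ‖y‖ ^ 2)) :=
  div_le_iff₀ (mul_pos (one_sub_norm_sq_pos ha) (one_sub_norm_sq_pos hy))

/-- The closed hyperbolic ball of centre `a` on which `hypS a ≤ 1 / 16`. -/
def hypBall (a : EuclideanSpace ℝ (Fin n)) : Set (EuclideanSpace ℝ (Fin n)) :=
  {y | ‖y - a‖ ^ 2 ≤ 1 / 16 * ((1 - ‖a‖ ^ 2) * (1 - ‖y‖ ^ 2))}

/-- The defining inequality carries no denominator, so it is closed in the whole space; off the open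
ball its right side is nonpositive, which would force `y = a`. -/
theorem hypBall_subset (ha : a ∈ ball 0 1) : hypBall a ⊆ ball 0 1 := by
  intro y hy
  have hρ := one_sub_norm_sq_pos ha
  have hy' : ‖y - a‖ ^ 2 ≤ 1 / 16 * ((1 - ‖a‖ ^ 2) * (1 - ‖y‖ ^ 2)) := hy
  rw [mem_ball_zero_iff]
  by_contra! h
  have h1 : 1 - ‖y‖ ^ 2 ≤ 0 := by nlinarith
  have h2 : ‖y - a‖ ^ 2 ≤ 0 := by nlinarith
  have h3 : ‖y - a‖ = 0 := by nlinarith [norm_nonneg (y - a)]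
  have h4 : y = a := sub_eq_zero.1 (norm_eq_zero.1 h3)
  rw [h4] at h
  have : ‖a‖ < 1 := by simpa using ha
  linarith

theorem isCompact_hypBall (ha : a ∈ ball 0 1) : IsCompact (hypBall a) := by
  refine isCompact_of_isClosed_isBounded ?_ (isBounded_ball.subset (hypBall_subset ha))
  exact isClosed_le (by fun_prop) (by fun_prop)

theorem hypS_gt_of_notMem (ha : a ∈ ball 0 1) (hy : y ∈ ball 0 1) (h : y ∉ hypBall a) :
    1 / 16 < hypS a y := by
  by_contra! h'
  exact h ((hypS_le_iff ha hy).1 h')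

theorem continuousOn_hypS (ha : a ∈ ball 0 1) : ContinuousOn (hypS a) (ball 0 1) :=
  fun _ hx => (contDiffAt_hypS ha hx (m := 0)).continuousAt.continuousWithinAt

theorem integrable_radial_mul (ha : a ∈ ball 0 1) {F : ℝ → ℝ} (hF : Continuous F)
    (hF0 : ∀ s, 1 / 16 ≤ s → F s = 0) {w : EuclideanSpace ℝ (Fin n) → ℝ}
    (hw : ContinuousOn w (ball 0 1)) :
    Integrable (fun y => F (hypS a y) * w y) (invMeasure n) := by
  refine integrable_invMeasure_of_compact ((hF.comp_continuousOn (continuousOn_hypS ha)).mul hw)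
    (isCompact_hypBall ha) (hypBall_subset ha) fun y hy hyK => ?_
  rw [hF0 _ (hypS_gt_of_notMem ha hy hyK).le, zero_mul]

theorem integrable_greenFun_mul (ha : a ∈ ball 0 1) {ε : ℝ} (hε : 0 < ε) (hε' : ε ≤ 1 / 16)
    {w : EuclideanSpace ℝ (Fin n) → ℝ} (hw : ContinuousOn w (ball 0 1)) :
    Integrable (fun y => greenFun n ε (hypS a y) * w y) (invMeasure n) :=
  integrable_radial_mul ha (contDiff_greenFun hε hε').continuous
    (fun _ hs => greenFun_of_ge hε hε' hs) hw

theorem integrable_meanKernel_mul (ha : a ∈ ball 0 1) {ε : ℝ} (hε : 0 < ε) (hε' : ε ≤ 1 / 16)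
    {w : EuclideanSpace ℝ (Fin n) → ℝ} (hw : ContinuousOn w (ball 0 1)) :
    Integrable (fun y => meanKernel n ε (hypS a y) * w y) (invMeasure n) :=
  integrable_radial_mul ha (contDiff_meanKernel hε).continuous
    (fun _ hs => meanKernel_of_ge hε (hε'.trans hs)) hw

theorem hyperbolicLaplacian_greenFun (ha : a ∈ ball 0 1) (hy : y ∈ ball 0 1) {ε : ℝ} (hε : 0 < ε)
    (hε' : ε ≤ 1 / 16) : hyperbolicLaplacian (fun z => greenFun n ε (hypS a z)) y =
      meanKernel n (1 / 16) (hypS a y) - meanKernel n ε (hypS a y) := by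
  rw [hyperbolicLaplacian_comp (contDiff_greenFun hε hε').contDiffAt (contDiffAt_hypS ha hy),
    gradient_sq_hypS ha hy, hyperbolicLaplacian_hypS ha hy,
    radial_laplacian_greenFun hε hε' (hypS_nonneg ha hy)]

theorem integral_greenFun_mul (hn : 2 ≤ n) (ha : a ∈ ball 0 1) {ε : ℝ} (hε : 0 < ε)
    (hε' : ε ≤ 1 / 16) {v : EuclideanSpace ℝ (Fin n) → ℝ} (hv : ContDiffOn ℝ 2 v (ball 0 1)) :
    ∫ y, greenFun n ε (hypS a y) * hyperbolicLaplacian v y ∂invMeasure n =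
      ∫ y, meanKernel n (1 / 16) (hypS a y) * v y ∂invMeasure n -
        ∫ y, meanKernel n ε (hypS a y) * v y ∂invMeasure n := by
  have hG : ContDiffOn ℝ 2 (fun z => greenFun n ε (hypS a z)) (ball 0 1) := fun z hz =>
    ((contDiff_greenFun hε hε').contDiffAt.comp z (contDiffAt_hypS ha hz)).contDiffWithinAt
  rw [green hn hv hG (isCompact_hypBall ha) (hypBall_subset ha) fun y hy hyK =>
    greenFun_of_ge hε hε' (hypS_gt_of_notMem ha hy hyK).le, ← integral_sub]
  · refine integral_congr_ae (ae_invMeasure_of_ball fun y hy => ?_)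
    simp only [hyperbolicLaplacian_greenFun ha hy hε hε']
    ring
  · exact integrable_meanKernel_mul ha (by norm_num) le_rfl hv.continuousOn
  · exact integrable_meanKernel_mul ha hε hε' hv.continuousOn

/-- The total mass of the mean value kernel. -/
noncomputable def kernelMass (a : EuclideanSpace ℝ (Fin n)) : ℝ :=
  ∫ y, meanKernel n (1 / 16) (hypS a y) ∂invMeasure n

theorem integrable_meanKernel (ha : a ∈ ball 0 1) {ε : ℝ} (hε : 0 < ε) (hε' : ε ≤ 1 / 16) :
    Integrable (fun y => meanKernel n ε (hypS a y)) (invMeasure n) := by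
  simpa using integrable_meanKernel_mul ha hε hε' (continuousOn_const (c := (1 : ℝ)))

/-- Test the Green identity with the constant `1`: its Laplacian vanishes, so the masses at all
scales agree. -/
theorem kernelMass_eq (hn : 2 ≤ n) (ha : a ∈ ball 0 1) {ε : ℝ} (hε : 0 < ε) (hε' : ε ≤ 1 / 16) :
    ∫ y, meanKernel n ε (hypS a y) ∂invMeasure n = kernelMass a := by
  have := integral_greenFun_mul hn ha hε hε' (v := fun _ => 1) contDiffOn_const
  simp only [hyperbolicLaplacian_const, mul_zero, integral_zero, mul_one] at this
  rw [kernelMass]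
  linarith

theorem kernelMass_nonneg : 0 ≤ kernelMass a :=
  integral_nonneg fun _ => meanKernel_nonneg (by norm_num)

/-- The limit form of the mean value formula for the hyperbolic Laplacian. -/
theorem tendsto_integral_greenFun_mul (hn : 2 ≤ n) (ha : a ∈ ball 0 1)
    {v : EuclideanSpace ℝ (Fin n) → ℝ} (hv : ContDiffOn ℝ 2 v (ball 0 1)) (c : ℝ) :
    Tendsto (fun ε => ∫ y, greenFun n ε (hypS a y) * hyperbolicLaplacian v y ∂invMeasure n)
      (𝓝[>] 0) (𝓝 (∫ y, meanKernel n (1 / 16) (hypS a y) * (v y - c) ∂invMeasure n -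
        kernelMass a * (v a - c))) := by
  -- Equality of masses means a constant subtracted from `v` shifts both terms of the formula
  -- equally. This leaves `c` free, to be chosen as a convenient value of `v` later.
  have hsplit : ∀ b : ℝ, ∀ ε : ℝ, 0 < ε → ε ≤ 1 / 16 →
      ∫ y, meanKernel n ε (hypS a y) * (v y - b) ∂invMeasure n =
        ∫ y, meanKernel n ε (hypS a y) * v y ∂invMeasure n - kernelMass a * b := by
    intro b ε hε hε'
    rw [← kernelMass_eq hn ha hε hε', ← integral_mul_const, ← integral_sub]
    · simp only [mul_sub]
    · exact integrable_meanKernel_mul ha hε hε' hv.continuousOn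
    · exact (integrable_meanKernel ha hε hε').mul_const b
  rw [hsplit c _ (by norm_num) le_rfl]
  rw [Metric.tendsto_nhds]
  intro η hη
  have hva : ContinuousAt v a := (contDiffAt_of_ball hv ha).continuousAt
  obtain ⟨δ, hδ, hδv⟩ := Metric.continuousAt_iff.1 hva (η / (2 * (kernelMass a + 1)))
    (by have := kernelMass_nonneg (a := a); positivity)
  have hmass := kernelMass_nonneg (a := a)
  -- On the support of the kernel, `|y - a|² ≤ ε ρ(a) ρ(y) ≤ ε < δ²`.
  filter_upwards [Ioo_mem_nhdsGT (show (0 : ℝ) < min (1 / 16) (δ ^ 2) by positivity)] with ε hε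
  have hε1 : ε ≤ 1 / 16 := hε.2.le.trans (min_le_left _ _)
  have hε2 : ε < δ ^ 2 := hε.2.trans_le (min_le_right _ _)
  rw [integral_greenFun_mul hn ha hε.1 hε1 hv, Real.dist_eq]
  have hb : |∫ y, meanKernel n ε (hypS a y) * (v y - v a) ∂invMeasure n| ≤
      η / (2 * (kernelMass a + 1)) * kernelMass a := by
    have hc : ∫ y, η / (2 * (kernelMass a + 1)) * meanKernel n ε (hypS a y) ∂invMeasure n =
        η / (2 * (kernelMass a + 1)) * kernelMass a := by
      rw [integral_const_mul, kernelMass_eq hn ha hε.1 hε1]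
    rw [← hc, ← Real.norm_eq_abs]
    refine norm_integral_le_of_norm_le ((integrable_meanKernel ha hε.1 hε1).const_mul _)
      (ae_invMeasure_of_ball fun y hy => ?_)
    rw [norm_mul, mul_comm, Real.norm_of_nonneg (meanKernel_nonneg hε.1)]
    rcases le_or_gt ε (hypS a y) with h | h
    · simp [meanKernel_of_ge hε.1 h]
    · refine mul_le_mul_of_nonneg_right ?_ (meanKernel_nonneg hε.1)
      have h1 := (hypS_le_iff ha hy).1 h.le
      have h2 : ‖y - a‖ ^ 2 ≤ ε := by
        refine h1.trans ?_
        have := one_sub_norm_sq_pos hy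
        have := one_sub_norm_sq_pos ha
        have h4 : (1 - ‖a‖ ^ 2) * (1 - ‖y‖ ^ 2) ≤ 1 :=
          mul_le_one₀ (by nlinarith [norm_nonneg a]) (one_sub_norm_sq_pos hy).le
            (by nlinarith [norm_nonneg y])
        nlinarith [hε.1]
      have h3 : dist y a < δ := by
        rw [dist_eq_norm]
        exact lt_of_pow_lt_pow_left₀ 2 hδ.le (h2.trans_lt hε2)
      exact (hδv h3).le
  rw [hsplit (v a) ε hε.1 hε1] at hb
  calc _ = |∫ y, meanKernel n ε (hypS a y) * v y ∂invMeasure n - kernelMass a * v a| := by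
        rw [abs_sub_comm]; congr 1; ring
    _ ≤ η / (2 * (kernelMass a + 1)) * kernelMass a := hb
    _ < η := by
        rw [div_mul_eq_mul_div, div_lt_iff₀ (by positivity)]
        nlinarith

end

/-! ### Comparison of distances and weights on hyperbolic balls. -/

section

variable {n : ℕ} {a b x y : EuclideanSpace ℝ (Fin n)}

theorem one_sub_norm_sq_le_one : 1 - ‖x‖ ^ 2 ≤ 1 := by nlinarith [norm_nonneg x]

theorem abs_norm_sq_sub_le (ha : a ∈ ball 0 1) (hy : y ∈ ball 0 1) :
    |(1 - ‖y‖ ^ 2) - (1 - ‖a‖ ^ 2)| ≤ 2 * ‖y - a‖ := by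
  have h1 : ‖a‖ < 1 := by simpa using ha
  have h2 : ‖y‖ < 1 := by simpa using hy
  have h3 : |‖y‖ - ‖a‖| ≤ ‖y - a‖ := abs_norm_sub_norm_le y a
  have h4 : (1 - ‖y‖ ^ 2) - (1 - ‖a‖ ^ 2) = -((‖y‖ - ‖a‖) * (‖y‖ + ‖a‖)) := by ring
  rw [h4, abs_neg, abs_mul, abs_of_nonneg (by positivity : 0 ≤ ‖y‖ + ‖a‖)]
  nlinarith [abs_nonneg (‖y‖ - ‖a‖), norm_nonneg (y - a), norm_nonneg y, norm_nonneg a]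

/-- By the arithmetic-geometric mean, `|y - a| ≤ (ρ(a) + ρ(y))/8`, while `|ρ(y) - ρ(a)| ≤ 2|y - a|`.
Solving gives the ratio bounds `3/5` and `5/3`, and then `(1 + 5/3)/8 = 1/3`. -/
theorem comparable_of_mem_hypBall (ha : a ∈ ball 0 1) (hy : y ∈ hypBall a) :
    3 / 5 * (1 - ‖a‖ ^ 2) ≤ 1 - ‖y‖ ^ 2 ∧ 1 - ‖y‖ ^ 2 ≤ 5 / 3 * (1 - ‖a‖ ^ 2) ∧
      ‖y - a‖ ≤ (1 - ‖a‖ ^ 2) / 3 := by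
  have hyb := hypBall_subset ha hy
  have h1 := one_sub_norm_sq_pos ha
  have h2 := one_sub_norm_sq_pos hyb
  have h3 := abs_le.1 (abs_norm_sq_sub_le ha hyb)
  have h4 : ‖y - a‖ ^ 2 ≤ 1 / 16 * ((1 - ‖a‖ ^ 2) * (1 - ‖y‖ ^ 2)) := hy
  have h5 : ‖y - a‖ ≤ ((1 - ‖a‖ ^ 2) + (1 - ‖y‖ ^ 2)) / 8 := by
    refine abs_le_of_sq_le_sq' ?_ (by positivity) |>.2
    nlinarith [sq_nonneg ((1 - ‖a‖ ^ 2) - (1 - ‖y‖ ^ 2))]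
  refine ⟨?_, ?_, ?_⟩ <;> linarith

theorem sqrt_hypS (ha : a ∈ ball 0 1) :
    √(hypS a y) = ‖y - a‖ / (√(1 - ‖a‖ ^ 2) * √(1 - ‖y‖ ^ 2)) := by
  rw [hypS, Real.sqrt_div (sq_nonneg _), Real.sqrt_sq (norm_nonneg _),
    Real.sqrt_mul (one_sub_norm_sq_pos ha).le]

/-- Meant for `A, B, Y` the square roots of `ρ(a), ρ(b), ρ(y)` and `p, q` the distances from `y` to
`a, b`: the numerator is varied first, then the denominator. -/
theorem abs_div_sub_div_le {A B Y p q δ : ℝ} (hA : 0 < A) (hB : A / 2 ≤ B) (hY : A / 2 ≤ Y)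
    (hq0 : 0 ≤ q) (hq : q ≤ A ^ 2 / 2) (hpq : |p - q| ≤ δ) (hAB : |B ^ 2 - A ^ 2| ≤ 2 * δ) :
    |p / (A * Y) - q / (B * Y)| ≤ 6 * δ / A ^ 2 := by
  have hB0 : 0 < B := by linarith
  have hY0 : 0 < Y := by linarith
  have hδ : 0 ≤ δ := (abs_nonneg _).trans hpq
  have e : p / (A * Y) - q / (B * Y) = (p - q) / (A * Y) + q * (B - A) / (A * B * Y) := by
    field_simp; ring
  have h1 : |(p - q) / (A * Y)| ≤ 2 * δ / A ^ 2 := by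
    rw [abs_div, abs_of_pos (by positivity : 0 < A * Y), div_le_div_iff₀ (by positivity)
      (by positivity)]
    have : A ^ 2 ≤ 2 * (A * Y) := by nlinarith
    calc |p - q| * A ^ 2 ≤ δ * (2 * (A * Y)) := by gcongr
      _ = _ := by ring
  have h2 : |B - A| * A ≤ 2 * δ := by
    refine le_trans ?_ hAB
    rw [show B ^ 2 - A ^ 2 = (B - A) * (B + A) by ring, abs_mul,
      abs_of_pos (by positivity : 0 < B + A)]
    gcongr
    linarith
  have h3 : |q * (B - A) / (A * B * Y)| ≤ 4 * δ / A ^ 2 := by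
    rw [abs_div, abs_mul, abs_of_nonneg hq0, abs_of_pos (by positivity : 0 < A * B * Y),
      div_le_div_iff₀ (by positivity) (by positivity)]
    have h4 : A ^ 2 ≤ 4 * (B * Y) := by nlinarith
    calc q * |B - A| * A ^ 2 ≤ A ^ 2 / 2 * |B - A| * A ^ 2 := by gcongr
      _ = A ^ 3 / 2 * (|B - A| * A) := by ring
      _ ≤ A ^ 3 / 2 * (2 * δ) := by gcongr
      _ = δ * A * A ^ 2 := by ring
      _ ≤ δ * A * (4 * (B * Y)) := by gcongr
      _ = _ := by ring
  rw [e]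
  refine (abs_add_le _ _).trans ((add_le_add h1 h3).trans (le_of_eq ?_))
  ring

/-- The geometry of a point in the union of two overlapping hyperbolic balls. -/
theorem geometry_of_mem_union (ha : a ∈ ball 0 1) (hb : b ∈ ball 0 1)
    (hab : ‖a - b‖ ≤ (1 - ‖a‖ ^ 2) / 16) (hy : y ∈ hypBall a ∪ hypBall b) :
    y ∈ ball 0 1 ∧ (1 - ‖a‖ ^ 2) / 2 ≤ 1 - ‖y‖ ^ 2 ∧ 1 - ‖y‖ ^ 2 ≤ 2 * (1 - ‖a‖ ^ 2) ∧
      (1 - ‖b‖ ^ 2) / 2 ≤ 1 - ‖y‖ ^ 2 ∧ 1 - ‖y‖ ^ 2 ≤ 2 * (1 - ‖b‖ ^ 2) ∧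
      1 - ‖b‖ ^ 2 ≤ 2 * (1 - ‖a‖ ^ 2) ∧ ‖y - a‖ ≤ (1 - ‖a‖ ^ 2) / 2 ∧
      |√(hypS a y) - √(hypS b y)| ≤ 6 * ‖a - b‖ / (1 - ‖a‖ ^ 2) ∧
      √(hypS a y) ≤ 1 ∧ √(hypS b y) ≤ 2 := by
  have h1 := one_sub_norm_sq_pos ha
  have h2 := one_sub_norm_sq_pos hb
  have h3 := abs_norm_sq_sub_le hb ha
  have h3' := abs_le.1 h3
  have hyb : y ∈ ball 0 1 := hy.elim (fun h => hypBall_subset ha h) fun h => hypBall_subset hb h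
  have h4 := one_sub_norm_sq_pos hyb
  have ht1 : ‖y - b‖ ≤ ‖y - a‖ + ‖a - b‖ := norm_sub_le_norm_sub_add_norm_sub y a b
  have ht2 : ‖y - a‖ ≤ ‖y - b‖ + ‖a - b‖ := by
    have := norm_sub_le_norm_sub_add_norm_sub y b a
    rwa [norm_sub_rev b a] at this
  have hg : (1 - ‖a‖ ^ 2) / 2 ≤ 1 - ‖y‖ ^ 2 ∧ 1 - ‖y‖ ^ 2 ≤ 2 * (1 - ‖a‖ ^ 2) ∧
      (1 - ‖b‖ ^ 2) / 2 ≤ 1 - ‖y‖ ^ 2 ∧ 1 - ‖y‖ ^ 2 ≤ 2 * (1 - ‖b‖ ^ 2) ∧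
      1 - ‖b‖ ^ 2 ≤ 2 * (1 - ‖a‖ ^ 2) ∧ ‖y - a‖ ≤ (1 - ‖a‖ ^ 2) / 2 ∧
      ‖y - b‖ ≤ (1 - ‖a‖ ^ 2) / 2 := by
    rcases hy with hy | hy
    · obtain ⟨c1, c2, c3⟩ := comparable_of_mem_hypBall ha hy
      refine ⟨?_, ?_, ?_, ?_, ?_, ?_, ?_⟩ <;> linarith
    · obtain ⟨c1, c2, c3⟩ := comparable_of_mem_hypBall hb hy
      refine ⟨?_, ?_, ?_, ?_, ?_, ?_, ?_⟩ <;> linarith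
  obtain ⟨g1, g2, g3, g4, g5, g6, g7⟩ := hg
  refine ⟨hyb, g1, g2, g3, g4, g5, g6, ?_⟩
  have hsq : ∀ {p q : ℝ}, 0 < p → p / 4 ≤ q → √p / 2 ≤ √q := by
    intro p q hp hpq
    refine Real.le_sqrt_of_sq_le ?_
    rw [div_pow, Real.sq_sqrt hp.le]
    linarith
  have hA := Real.sqrt_pos.2 h1
  have hB : √(1 - ‖a‖ ^ 2) / 2 ≤ √(1 - ‖b‖ ^ 2) := hsq h1 (by linarith)
  have hY : √(1 - ‖a‖ ^ 2) / 2 ≤ √(1 - ‖y‖ ^ 2) := hsq h1 (by linarith)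
  have eA := Real.sq_sqrt h1.le
  have eB := Real.sq_sqrt h2.le
  rw [sqrt_hypS ha, sqrt_hypS hb]
  refine ⟨?_, ?_, ?_⟩
  · have := abs_div_sub_div_le (p := ‖y - a‖) (q := ‖y - b‖) (δ := ‖a - b‖) hA hB hY
      (norm_nonneg _) (by rw [eA]; exact g7) (abs_le.2 ⟨by linarith, by linarith⟩)
      (by rw [eA, eB, abs_sub_comm]; exact h3)
    rwa [eA] at this
  · rw [div_le_one (mul_pos hA (by linarith))]
    nlinarith
  · rw [div_le_iff₀ (mul_pos (by linarith) (by linarith))]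
    nlinarith [mul_le_mul hB hY (by positivity) (by linarith)]

/-- The points `a` and `b` are exempted because the kernel bounds are singular there; `n ≥ 1` makes
them null. -/
theorem abs_integral_invMeasure_le {F G : EuclideanSpace ℝ (Fin n) → ℝ} (hn : 1 ≤ n)
    (hG : IntegrableOn G (ball 0 1)) (a b : EuclideanSpace ℝ (Fin n))
    (h : ∀ y ∈ ball (0 : EuclideanSpace ℝ (Fin n)) 1, y ≠ a → y ≠ b →
      invDensity y * |F y| ≤ G y) :
    |∫ y, F y ∂invMeasure n| ≤ ∫ y in ball 0 1, G y := by
  have : Nonempty (Fin n) := ⟨⟨0, hn⟩⟩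
  rw [integral_invMeasure, ← Real.norm_eq_abs]
  refine norm_integral_le_of_norm_le hG ?_
  have h1 : ∀ c : EuclideanSpace ℝ (Fin n),
      ∀ᵐ y ∂(volume : Measure (EuclideanSpace ℝ (Fin n))).restrict (ball 0 1), y ≠ c := fun c =>
    ae_restrict_of_ae (Measure.ae_ne volume c)
  filter_upwards [h1 a, h1 b, ae_restrict_mem measurableSet_ball] with y hya hyb hy
  rw [norm_mul, Real.norm_of_nonneg (invDensity_pos hy).le]
  exact h y hy hya hyb

/-- The powers of `ρ` are `-n` from the measure, `n - 1` from the kernel and `1 + α` from the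
source, leaving `ρ^α`. This is what fixes the weight in the hypothesis of the theorem. -/
theorem sqrt_hypS_pow_inv_mul_le (hn : 1 ≤ n) (ha : a ∈ ball 0 1) (hy : y ∈ ball 0 1) {α : ℝ}
    (hα₀ : 0 ≤ α) (hα₁ : α ≤ 1) (h1 : (1 - ‖a‖ ^ 2) / 2 ≤ 1 - ‖y‖ ^ 2)
    (h2 : 1 - ‖y‖ ^ 2 ≤ 2 * (1 - ‖a‖ ^ 2)) :
    invDensity y * ((√(hypS a y) ^ (n - 1))⁻¹ * (1 - ‖y‖ ^ 2) ^ (1 + α)) ≤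
      2 ^ n * (1 - ‖a‖ ^ 2) ^ α * (‖y - a‖ ^ (n - 1))⁻¹ := by
  have ha0 := one_sub_norm_sq_pos ha
  have hy0 := one_sub_norm_sq_pos hy
  obtain ⟨k, rfl⟩ := Nat.exists_eq_add_of_le' hn
  rw [Nat.add_sub_cancel, sqrt_hypS ha, div_pow, inv_div, invDensity]
  have h3 : √(1 - ‖a‖ ^ 2) * √(1 - ‖y‖ ^ 2) ≤ 2 * (1 - ‖y‖ ^ 2) := by
    rw [← Real.sqrt_mul ha0.le]
    refine Real.sqrt_le_iff.2 ⟨by positivity, by nlinarith⟩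
  have h4 : (1 - ‖y‖ ^ 2) ^ α ≤ 2 * (1 - ‖a‖ ^ 2) ^ α := by
    calc _ ≤ (2 * (1 - ‖a‖ ^ 2)) ^ α := Real.rpow_le_rpow hy0.le h2 hα₀
      _ = 2 ^ α * (1 - ‖a‖ ^ 2) ^ α := Real.mul_rpow (by norm_num) ha0.le
      _ ≤ 2 * (1 - ‖a‖ ^ 2) ^ α := by
        gcongr
        calc (2 : ℝ) ^ α ≤ 2 ^ (1 : ℝ) := Real.rpow_le_rpow_of_exponent_le (by norm_num) hα₁
          _ = 2 := Real.rpow_one 2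
  rw [Real.rpow_add hy0, Real.rpow_one]
  calc _ ≤ ((1 - ‖y‖ ^ 2) ^ (k + 1))⁻¹ * ((2 * (1 - ‖y‖ ^ 2)) ^ k / ‖y - a‖ ^ k *
        ((1 - ‖y‖ ^ 2) * (2 * (1 - ‖a‖ ^ 2) ^ α))) := by gcongr
    _ = _ := by
      rw [mul_pow, pow_succ, pow_succ]
      field_simp
      ring

end

/-! ### Potential estimates and uniform kernel bounds. -/

section

variable {n : ℕ} {a b x y : EuclideanSpace ℝ (Fin n)}

/-- The potentials `∫ |y - a|¹⁻ⁿ g(y) dy` are bounded by `C`, uniformly in `a`. -/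
def PotentialBound (g : EuclideanSpace ℝ (Fin n) → ℝ) (C : ℝ) : Prop :=
  ∀ a ∈ ball (0 : EuclideanSpace ℝ (Fin n)) 1,
    IntegrableOn (fun y => (‖y - a‖ ^ (n - 1))⁻¹ * g y) (ball 0 1) ∧
      ∫ y in ball 0 1, (‖y - a‖ ^ (n - 1))⁻¹ * g y ≤ C

/-- Young's inequality splits the product into `|y - a|^(-(n-1)q)` and `g^p`. The first is locally
integrable since `(n-1)q < n` is equivalent to `p > n`, and translation invariance makes the bound
uniform in `a`. -/
theorem exists_potentialBound (hn : 2 ≤ n) {g : EuclideanSpace ℝ (Fin n) → ℝ} {p : ℝ}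
    (hp : n < p) (hg0 : ∀ y, 0 ≤ g y)
    (hgm : AEStronglyMeasurable g (volume.restrict (ball 0 1)))
    (hg : IntegrableOn (fun y => g y ^ p) (ball 0 1)) :
    ∃ C, 0 ≤ C ∧ PotentialBound g C := by
  have hn1 : (2 : ℝ) ≤ n := by exact_mod_cast hn
  have hp1 : 1 < p := by linarith
  have hpq := (Real.HolderConjugate.conjExponent hp1).symm
  set q := p.conjExponent with hq
  have hq1 : 1 < q := hpq.lt
  have hβ : ((n : ℝ) - 1) * q < n := by
    rw [hq, Real.conjExponent, mul_div_assoc', div_lt_iff₀ (by linarith)]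
    nlinarith
  -- Radius `2` contains all differences of points of the unit ball.
  let F : EuclideanSpace ℝ (Fin n) → ℝ :=
    (ball 0 2).indicator fun z => ‖z‖ ^ (-(((n : ℝ) - 1) * q))
  have hF : Integrable F := by
    refine (integrable_indicator_iff measurableSet_ball).2 ?_
    refine integrableOn_ball_of_norm_le_rpow (C := 1) (α := ((n : ℝ) - 1) * q) ?_ ?_ ?_ ?_
    · simp; omega
    · simpa using hβ
    · refine Eventually.of_forall fun z => ?_
      rw [one_mul, Real.norm_of_nonneg (by positivity)]
    · exact (by fun_prop : Measurable fun z : EuclideanSpace ℝ (Fin n) =>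
        ‖z‖ ^ (-(((n : ℝ) - 1) * q))).aestronglyMeasurable
  have hF0 : ∀ z, 0 ≤ F z := fun z => indicator_nonneg (fun z _ => by positivity) z
  have hpt : ∀ a ∈ ball (0 : EuclideanSpace ℝ (Fin n)) 1, ∀ y ∈ ball 0 1,
      (‖y - a‖ ^ (n - 1))⁻¹ * g y ≤ F (y - a) + g y ^ p := by
    intro a ha y hy
    have hmem : y - a ∈ ball (0 : EuclideanSpace ℝ (Fin n)) 2 := by
      rw [mem_ball_zero_iff] at *
      linarith [norm_sub_le y a]
    have e : ((‖y - a‖ ^ (n - 1))⁻¹) ^ q = F (y - a) := by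
      simp only [F]
      rw [indicator_of_mem hmem, Real.inv_rpow (by positivity), ← Real.rpow_natCast,
        ← Real.rpow_mul (norm_nonneg _), Real.rpow_neg (norm_nonneg _),
        Nat.cast_sub (by omega), Nat.cast_one]
    have h1 := Real.young_inequality_of_nonneg (inv_nonneg.2 (by positivity :
      0 ≤ ‖y - a‖ ^ (n - 1))) (hg0 y) hpq
    rw [e] at h1
    refine h1.trans (add_le_add (div_le_self (hF0 _) hq1.le)
      (div_le_self (Real.rpow_nonneg (hg0 y) _) hp1.le))
  refine ⟨(∫ z, F z) + ∫ y in ball 0 1, g y ^ p, add_nonneg (integral_nonneg hF0)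
    (integral_nonneg fun y => Real.rpow_nonneg (hg0 y) _), fun a ha => ?_⟩
  have hFa : Integrable fun y => F (y - a) := hF.comp_sub_right a
  have hdom : IntegrableOn (fun y => F (y - a) + g y ^ p) (ball 0 1) := hFa.integrableOn.add hg
  have hint : IntegrableOn (fun y => (‖y - a‖ ^ (n - 1))⁻¹ * g y) (ball 0 1) := by
    refine Integrable.mono' hdom ?_ ?_
    · exact ((by fun_prop : Measurable fun y : EuclideanSpace ℝ (Fin n) =>
        (‖y - a‖ ^ (n - 1))⁻¹).aestronglyMeasurable).mul hgm
    · filter_upwards [ae_restrict_mem measurableSet_ball] with y hy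
      rw [Real.norm_of_nonneg (mul_nonneg (by positivity) (hg0 y))]
      exact hpt a ha y hy
  refine ⟨hint, ?_⟩
  calc ∫ y in ball 0 1, (‖y - a‖ ^ (n - 1))⁻¹ * g y
      ≤ ∫ y in ball 0 1, (F (y - a) + g y ^ p) :=
        setIntegral_mono_on hint hdom measurableSet_ball (hpt a ha)
    _ = (∫ y in ball 0 1, F (y - a)) + ∫ y in ball 0 1, g y ^ p :=
        integral_add hFa.integrableOn hg
    _ ≤ (∫ y, F (y - a)) + ∫ y in ball 0 1, g y ^ p := by
        gcongr ?_ + _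
        exact setIntegral_le_integral hFa (Eventually.of_forall fun y => hF0 _)
    _ = _ := by rw [integral_sub_right_eq_self (μ := volume) F a]

theorem sqrt_hypS_pos (ha : a ∈ ball 0 1) (hy : y ∈ ball 0 1) (hya : y ≠ a) :
    0 < √(hypS a y) := by
  rw [sqrt_hypS ha]
  exact div_pos (norm_pos_iff.2 (sub_ne_zero.2 hya)) (mul_pos
    (Real.sqrt_pos.2 (one_sub_norm_sq_pos ha)) (Real.sqrt_pos.2 (one_sub_norm_sq_pos hy)))

theorem abs_integral_greenFun_mul_le (hn : 1 ≤ n) {f g : EuclideanSpace ℝ (Fin n) → ℝ} {C α : ℝ}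
    (hα₀ : 0 ≤ α) (hα₁ : α ≤ 1) (hC : PotentialBound g C)
    (hf : ∀ y ∈ ball 0 1, |f y| ≤ (1 - ‖y‖ ^ 2) ^ (1 + α) * g y) (hg : ∀ y, 0 ≤ g y)
    (ha : a ∈ ball 0 1) {ε : ℝ} (hε : 0 < ε) (hε' : ε ≤ 1 / 16) :
    |∫ y, greenFun n ε (hypS a y) * f y ∂invMeasure n| ≤ 2 ^ n * C * (1 - ‖a‖ ^ 2) ^ α := by
  have ha0 := one_sub_norm_sq_pos ha
  obtain ⟨hi, hb⟩ := hC a ha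
  calc _ ≤ ∫ y in ball 0 1, 2 ^ n * (1 - ‖a‖ ^ 2) ^ α * ((‖y - a‖ ^ (n - 1))⁻¹ * g y) := by
        refine abs_integral_invMeasure_le hn (hi.const_mul _) a a fun y hy hya _ => ?_
        have hw := invDensity_pos hy
        rw [abs_mul, abs_of_nonneg (greenFun_nonneg hε hε')]
        by_cases hyK : y ∈ hypBall a
        · obtain ⟨c1, c2, -⟩ := comparable_of_mem_hypBall ha hyK
          have h1 := sqrt_hypS_pow_inv_mul_le hn ha hy hα₀ hα₁ (by linarith) (by linarith)
          have h2 := greenFun_sq_le hn hε hε' (sqrt_hypS_pos ha hy hya)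
          rw [Real.sq_sqrt (hypS_nonneg ha hy)] at h2
          calc _ ≤ invDensity y * ((√(hypS a y) ^ (n - 1))⁻¹ *
                ((1 - ‖y‖ ^ 2) ^ (1 + α) * g y)) := by
                gcongr
                exact hf y hy
            _ = invDensity y * ((√(hypS a y) ^ (n - 1))⁻¹ * (1 - ‖y‖ ^ 2) ^ (1 + α)) * g y := by
                ring
            _ ≤ 2 ^ n * (1 - ‖a‖ ^ 2) ^ α * (‖y - a‖ ^ (n - 1))⁻¹ * g y := by
                gcongr
                exact hg y
            _ = _ := by ring
        · rw [greenFun_of_ge hε hε' (hypS_gt_of_notMem ha hy hyK).le, zero_mul, mul_zero]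
          have := hg y
          positivity
    _ ≤ _ := by
        rw [integral_const_mul]
        calc _ ≤ 2 ^ n * (1 - ‖a‖ ^ 2) ^ α * C := by gcongr
          _ = _ := by ring

/-- Keeping both singular terms on the right makes the bound symmetric, so later estimates need not
know which centre is nearer. -/
theorem abs_greenFun_sub_le (hn : 1 ≤ n) {ε s t : ℝ} (hε : 0 < ε) (hε' : ε ≤ 1 / 16)
    (hs : 0 < √s) (ht : 0 < √t) :
    |greenFun n ε s - greenFun n ε t| ≤
      2 * ((√s ^ (n - 1))⁻¹ + (√t ^ (n - 1))⁻¹) * |√s - √t| := by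
  have key : ∀ {r r' : ℝ}, 0 < √r → √r ≤ √r' → |greenFun n ε r' - greenFun n ε r| ≤
      2 * ((√r ^ (n - 1))⁻¹ + (√r' ^ (n - 1))⁻¹) * |√r - √r'| := by
    intro r r' hr hrr
    have h := abs_greenFun_sq_sub_le hn hε hε' hr hrr
    have hr' := hr.trans_le hrr
    rw [Real.sq_sqrt (Real.sqrt_pos.1 hr).le, Real.sq_sqrt (Real.sqrt_pos.1 hr').le] at h
    rw [abs_sub_comm (√r), abs_of_nonneg (sub_nonneg.2 hrr)]
    refine h.trans ?_
    have : 0 ≤ (√r' ^ (n - 1))⁻¹ := by positivity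
    exact mul_le_mul_of_nonneg_right (by linarith) (sub_nonneg.2 hrr)
  rcases le_total √s √t with h | h
  · rw [abs_sub_comm]; exact key hs h
  · rw [add_comm, abs_sub_comm √s]; exact key ht h

theorem abs_integral_greenFun_sub_mul_le (hn : 1 ≤ n) {f g : EuclideanSpace ℝ (Fin n) → ℝ}
    {C α : ℝ} (hα₀ : 0 ≤ α) (hα₁ : α ≤ 1) (hC : PotentialBound g C)
    (hf : ∀ y ∈ ball 0 1, |f y| ≤ (1 - ‖y‖ ^ 2) ^ (1 + α) * g y) (hg : ∀ y, 0 ≤ g y)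
    (ha : a ∈ ball 0 1) (hb : b ∈ ball 0 1) (hab : ‖a - b‖ ≤ (1 - ‖a‖ ^ 2) / 16)
    {ε : ℝ} (hε : 0 < ε) (hε' : ε ≤ 1 / 16) :
    |∫ y, (greenFun n ε (hypS a y) - greenFun n ε (hypS b y)) * f y ∂invMeasure n| ≤
      48 * 2 ^ n * C * (1 - ‖a‖ ^ 2) ^ α * (‖a - b‖ / (1 - ‖a‖ ^ 2)) := by
  have ha0 := one_sub_norm_sq_pos ha
  have hb0 := one_sub_norm_sq_pos hb
  obtain ⟨hia, hba⟩ := hC a ha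
  obtain ⟨hib, hbb⟩ := hC b hb
  set D := ‖a - b‖ / (1 - ‖a‖ ^ 2) with hD
  have hD0 : 0 ≤ D := by positivity
  set T := (1 - ‖a‖ ^ 2) ^ α with hT
  have hT0 : 0 ≤ T := by positivity
  -- The factor `24` is `2` (kernel) times `6` (`geometry_of_mem_union`) times `2` (replacing
  -- `ρ(b)^α` by `ρ(a)^α`). It doubles to `48` because two potentials are added.
  calc _ ≤ ∫ y in ball 0 1, 24 * 2 ^ n * T * D *
        ((‖y - a‖ ^ (n - 1))⁻¹ * g y + (‖y - b‖ ^ (n - 1))⁻¹ * g y) := by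
        refine abs_integral_invMeasure_le hn ((hia.add hib).const_mul _) a b
          fun y hy hya hyb => ?_
        have hw := invDensity_pos hy
        have hgy := hg y
        rw [abs_mul]
        by_cases hyK : y ∈ hypBall a ∪ hypBall b
        · obtain ⟨-, c1, c2, c3, c4, c5, -, c6, -⟩ := geometry_of_mem_union ha hb hab hyK
          have h1 := sqrt_hypS_pow_inv_mul_le hn ha hy hα₀ hα₁ c1 c2
          have h2 := sqrt_hypS_pow_inv_mul_le hn hb hy hα₀ hα₁ c3 c4
          have h3 := abs_greenFun_sub_le hn hε hε' (sqrt_hypS_pos ha hy hya)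
            (sqrt_hypS_pos hb hy hyb)
          rw [mul_div_assoc] at c6
          have h4 : (1 - ‖b‖ ^ 2) ^ α ≤ 2 * T := by
            calc _ ≤ (2 * (1 - ‖a‖ ^ 2)) ^ α := Real.rpow_le_rpow hb0.le c5 hα₀
              _ = 2 ^ α * (1 - ‖a‖ ^ 2) ^ α := Real.mul_rpow (by norm_num) ha0.le
              _ ≤ 2 * T := by
                gcongr
                calc (2 : ℝ) ^ α ≤ 2 ^ (1 : ℝ) :=
                      Real.rpow_le_rpow_of_exponent_le (by norm_num) hα₁
                  _ = 2 := Real.rpow_one 2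
          set A := (√(hypS a y) ^ (n - 1))⁻¹ with hA
          set B := (√(hypS b y) ^ (n - 1))⁻¹ with hB
          have hA0 : 0 ≤ A := by positivity
          have hB0 : 0 ≤ B := by positivity
          calc _ ≤ invDensity y * (2 * (A + B) * (6 * D) * ((1 - ‖y‖ ^ 2) ^ (1 + α) * g y)) := by
                gcongr
                · refine h3.trans ?_
                  gcongr
                · exact hf y hy
            _ = 12 * D * g y * (invDensity y * (A * (1 - ‖y‖ ^ 2) ^ (1 + α)) +
                  invDensity y * (B * (1 - ‖y‖ ^ 2) ^ (1 + α))) := by ring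
            _ ≤ 12 * D * g y * (2 ^ n * T * (‖y - a‖ ^ (n - 1))⁻¹ +
                  2 ^ n * (1 - ‖b‖ ^ 2) ^ α * (‖y - b‖ ^ (n - 1))⁻¹) := by gcongr
            _ ≤ 12 * D * g y * (2 ^ n * (2 * T) * (‖y - a‖ ^ (n - 1))⁻¹ +
                  2 ^ n * (2 * T) * (‖y - b‖ ^ (n - 1))⁻¹) := by
                gcongr
                linarith
            _ = _ := by ring
        · rw [mem_union, not_or] at hyK
          rw [greenFun_of_ge hε hε' (hypS_gt_of_notMem ha hy hyK.1).le,
            greenFun_of_ge hε hε' (hypS_gt_of_notMem hb hy hyK.2).le, sub_zero, abs_zero,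
            zero_mul, mul_zero]
          positivity
    _ ≤ _ := by
        rw [integral_const_mul, integral_add hia hib]
        calc _ ≤ 24 * 2 ^ n * T * D * (C + C) := by gcongr
          _ = _ := by ring

/-- The volume of the unit ball. -/
noncomputable def unitVol (n : ℕ) : ℝ := volume.real (ball (0 : EuclideanSpace ℝ (Fin n)) 1)

theorem unitVol_pos : 0 < unitVol n :=
  ENNReal.toReal_pos (measure_ball_pos volume 0 one_pos).ne' measure_ball_lt_top.ne

theorem volume_real_closedBall {r : ℝ} (hr : 0 ≤ r) :
    volume.real (closedBall a r) = r ^ n * unitVol n := by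
  have := Measure.addHaar_real_closedBall (volume : Measure (EuclideanSpace ℝ (Fin n))) a hr
  simpa [unitVol] using this

theorem invDensity_le {r : ℝ} (hr : 0 < r) (h : r ≤ 1 - ‖y‖ ^ 2) : invDensity y ≤ (r ^ n)⁻¹ := by
  rw [invDensity]; gcongr

/-- The kernel is Lipschitz in `s`, and `s` is a square: the difference of roots is at most `6D` and
their sum at most `3`, whence `18`. The density bound `r⁻ⁿ` cancels the volume of the ball of radius
`r`. -/
theorem exists_meanKernel_sub_bound (n : ℕ) (hn : 1 ≤ n) : ∃ L, 0 ≤ L ∧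
    ∀ (v : EuclideanSpace ℝ (Fin n) → ℝ) (M : ℝ) (a b : EuclideanSpace ℝ (Fin n)), 0 ≤ M →
    a ∈ ball 0 1 → b ∈ ball 0 1 → ‖a - b‖ ≤ (1 - ‖a‖ ^ 2) / 16 →
    (∀ y ∈ ball 0 1, ‖y - a‖ ≤ (1 - ‖a‖ ^ 2) / 2 → |v y| ≤ M) →
    |∫ y, (meanKernel n (1 / 16) (hypS a y) - meanKernel n (1 / 16) (hypS b y)) * v y
      ∂invMeasure n| ≤ L * M * (‖a - b‖ / (1 - ‖a‖ ^ 2)) := by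
  obtain ⟨K, hK⟩ := exists_lipschitzWith_meanKernel (n := n) (ε := 1 / 16) (by norm_num)
  refine ⟨18 * K * unitVol n, by have := unitVol_pos (n := n); positivity, ?_⟩
  intro v M a b hM ha hb hab hv
  have ha0 := one_sub_norm_sq_pos ha
  set D := ‖a - b‖ / (1 - ‖a‖ ^ 2) with hD
  have hD0 : 0 ≤ D := by positivity
  set r := (1 - ‖a‖ ^ 2) / 2 with hr
  have hr0 : 0 < r := by positivity
  set c := 18 * K * D * M * (r ^ n)⁻¹ with hc
  have hc0 : 0 ≤ c := by positivity
  have hint : Integrable ((closedBall a r).indicator fun _ => c) :=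
    (integrable_indicator_iff measurableSet_closedBall).2 (integrableOn_const
      measure_closedBall_lt_top.ne)
  calc _ ≤ ∫ y in ball 0 1, (closedBall a r).indicator (fun _ => c) y := by
        refine abs_integral_invMeasure_le hn hint.integrableOn a b fun y hy _ _ => ?_
        have hw := invDensity_pos hy
        rw [abs_mul]
        by_cases hyK : y ∈ hypBall a ∪ hypBall b
        · obtain ⟨-, c1, -, -, -, -, c5, c6, c7, c8⟩ := geometry_of_mem_union ha hb hab hyK
          rw [mul_div_assoc] at c6
          rw [indicator_of_mem (by rwa [mem_closedBall, dist_eq_norm])]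
          have h1 := hK.dist_le_mul (hypS a y) (hypS b y)
          rw [Real.dist_eq, Real.dist_eq] at h1
          have h2 : |hypS a y - hypS b y| ≤ 6 * D * 3 := by
            rw [← Real.sq_sqrt (hypS_nonneg ha hy), ← Real.sq_sqrt (hypS_nonneg hb hy), sq_sub_sq,
              mul_comm, abs_mul, abs_of_nonneg (by positivity : 0 ≤ √(hypS a y) + √(hypS b y))]
            gcongr
            linarith
          calc _ ≤ (r ^ n)⁻¹ * (K * (6 * D * 3) * M) := by
                gcongr
                · exact invDensity_le hr0 c1
                · exact h1.trans (by gcongr)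
                · exact hv y hy c5
            _ = c := by rw [hc]; ring
        · rw [mem_union, not_or] at hyK
          rw [meanKernel_of_ge (by norm_num) (hypS_gt_of_notMem ha hy hyK.1).le,
            meanKernel_of_ge (by norm_num) (hypS_gt_of_notMem hb hy hyK.2).le, sub_zero, abs_zero,
            zero_mul, mul_zero]
          exact indicator_nonneg (fun _ _ => hc0) y
    _ ≤ ∫ y, (closedBall a r).indicator (fun _ => c) y :=
        setIntegral_le_integral hint (Eventually.of_forall fun y =>
          indicator_nonneg (fun _ _ => hc0) y)
    _ = _ := by
        rw [integral_indicator measurableSet_closedBall, setIntegral_const,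
          volume_real_closedBall hr0.le, hc, smul_eq_mul]
        field_simp

/-- The Euclidean ball of radius `ρ(a)/16` lies in `s ≤ 1/64`. There the density is at least
`(2ρ(a))⁻ⁿ`, the Green function at least `1/64` and the weight at least half its central value. The
case `t = 0` serves the mass bound, `t = α` the barrier. -/
theorem exists_greenFun_lower_bound (n : ℕ) : ∃ c, 0 < c ∧
    ∀ (a : EuclideanSpace ℝ (Fin n)) (ε t : ℝ), a ∈ ball 0 1 → 0 < ε → ε ≤ 1 / 64 → 0 ≤ t →
    t ≤ 1 → c * (1 - ‖a‖ ^ 2) ^ t ≤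
      ∫ y, greenFun n ε (hypS a y) * (1 - ‖y‖ ^ 2) ^ t ∂invMeasure n := by
  have hV := unitVol_pos (n := n)
  refine ⟨1 / 128 * (1 / 32) ^ n * unitVol n, by positivity, ?_⟩
  intro a ε t ha hε hε' ht0 ht1
  have ha0 := one_sub_norm_sq_pos ha
  have hε2 : ε ≤ 1 / 16 := by linarith
  set r := (1 - ‖a‖ ^ 2) / 16 with hr
  have hr0 : 0 < r := by positivity
  have ha1 : ‖a‖ < 1 := by simpa using ha
  have hsub : closedBall a r ⊆ ball 0 1 := by
    intro y hy
    rw [mem_closedBall, dist_eq_norm] at hy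
    rw [mem_ball_zero_iff]
    have := norm_sub_norm_le y a
    nlinarith [norm_nonneg a]
  have hint : IntegrableOn (fun y => invDensity y *
      (greenFun n ε (hypS a y) * (1 - ‖y‖ ^ 2) ^ t)) (ball 0 1) := by
    rw [← integrable_invMeasure_iff]
    refine integrable_greenFun_mul ha hε hε2 ?_
    exact ContinuousOn.rpow_const (by fun_prop) fun y _ => Or.inr ht0
  rw [integral_invMeasure]
  set c := ((2 * (1 - ‖a‖ ^ 2)) ^ n)⁻¹ * (1 / 64 * (1 / 2 * (1 - ‖a‖ ^ 2) ^ t)) with hc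
  calc _ = ∫ y in closedBall a r, c := by
        rw [setIntegral_const, volume_real_closedBall hr0.le, hc, hr, smul_eq_mul,
          one_div_pow, show (32 : ℝ) = 16 * 2 by norm_num, mul_pow, mul_pow, div_pow]
        field_simp
        norm_num
    _ ≤ ∫ y in closedBall a r, invDensity y *
          (greenFun n ε (hypS a y) * (1 - ‖y‖ ^ 2) ^ t) := by
        refine setIntegral_mono_on (integrableOn_const measure_closedBall_lt_top.ne)
          (hint.mono_set hsub) measurableSet_closedBall fun y hy => ?_
        have hyb := hsub hy
        have hy0 := one_sub_norm_sq_pos hyb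
        have hw := invDensity_pos hyb
        rw [mem_closedBall, dist_eq_norm] at hy
        have h1 := abs_le.1 (abs_norm_sq_sub_le ha hyb)
        have h2 : (1 - ‖a‖ ^ 2) / 2 ≤ 1 - ‖y‖ ^ 2 := by linarith
        have h3 : hypS a y ≤ 1 / 64 := by
          rw [hypS_le_iff ha hyb]
          calc ‖y - a‖ ^ 2 ≤ r ^ 2 := by gcongr
            _ ≤ 1 / 64 * ((1 - ‖a‖ ^ 2) * ((1 - ‖a‖ ^ 2) / 2)) := by rw [hr]; nlinarith
            _ ≤ _ := by gcongr
        have hG := greenFun_lower (n := n) hε hε' h3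
        have hG0 : 0 ≤ greenFun n ε (hypS a y) := le_trans (by norm_num) hG
        rw [hc]
        gcongr
        · exact inv_anti₀ (pow_pos hy0 n) (pow_le_pow_left₀ hy0.le (by linarith) n)
        · calc 1 / 2 * (1 - ‖a‖ ^ 2) ^ t ≤ (1 / 2) ^ t * (1 - ‖a‖ ^ 2) ^ t := by
                gcongr
                calc (1 / 2 : ℝ) = (1 / 2) ^ (1 : ℝ) := (Real.rpow_one _).symm
                  _ ≤ (1 / 2) ^ t :=
                    Real.rpow_le_rpow_of_exponent_ge (by norm_num) (by norm_num) ht1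
            _ = (1 / 2 * (1 - ‖a‖ ^ 2)) ^ t := (Real.mul_rpow (by norm_num) ha0.le).symm
            _ ≤ _ := Real.rpow_le_rpow (by positivity) (by linarith) ht0
    _ ≤ _ := by
        refine setIntegral_mono_set hint ?_ (LE.le.eventuallyLE hsub)
        filter_upwards [ae_restrict_mem measurableSet_ball] with y hy
        have h1 := (invDensity_pos hy).le
        have h2 := greenFun_nonneg (n := n) (s := hypS a y) hε hε2
        have h3 := one_sub_norm_sq_pos hy
        simp only [Pi.zero_apply]
        positivity

/-- Test the mean value formula with `hypS a` itself: it vanishes at `a`, has Laplacian at least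
`1`, and is at most `1` wherever the kernel is nonzero. -/
theorem exists_kernelMass_lower_bound (hn : 2 ≤ n) : ∃ c, 0 < c ∧
    ∀ a ∈ ball (0 : EuclideanSpace ℝ (Fin n)) 1, c ≤ kernelMass a := by
  obtain ⟨c, hc, h⟩ := exists_greenFun_lower_bound n
  refine ⟨c, hc, fun a ha => ?_⟩
  have hC : ContDiffOn ℝ 2 (hypS a) (ball 0 1) := fun x hx =>
    (contDiffAt_hypS ha hx).contDiffWithinAt
  have hlim := tendsto_integral_greenFun_mul hn ha hC 0
  have haa : hypS a a = 0 := by simp [hypS]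
  have hn1 : (2 : ℝ) ≤ n := by exact_mod_cast hn
  have h1 : c ≤ ∫ y, meanKernel n (1 / 16) (hypS a y) * (hypS a y - 0) ∂invMeasure n -
      kernelMass a * (hypS a a - 0) := by
    refine ge_of_tendsto hlim ?_
    filter_upwards [Ioo_mem_nhdsGT (show (0 : ℝ) < 1 / 64 by norm_num)] with ε hε
    have hε2 : ε ≤ 1 / 16 := by linarith [hε.2]
    have := h a ε 0 ha hε.1 hε.2.le le_rfl zero_le_one
    simp only [Real.rpow_zero, mul_one] at this
    refine this.trans ?_
    refine integral_mono_ae ?_ ?_ (ae_invMeasure_of_ball fun y hy => ?_)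
    · simpa using integrable_greenFun_mul ha hε.1 hε2 (continuousOn_const (c := (1 : ℝ)))
    · exact integrable_greenFun_mul ha hε.1 hε2 (continuousOn_hyperbolicLaplacian hC)
    · have h2 := greenFun_nonneg (n := n) (s := hypS a y) hε.1 hε2
      have h3 := hypS_nonneg ha hy
      simp only [hyperbolicLaplacian_hypS ha hy]
      refine le_mul_of_one_le_right h2 ?_
      nlinarith
  rw [haa] at h1
  simp only [sub_zero, mul_zero] at h1
  refine h1.trans ?_
  rw [kernelMass]
  refine integral_mono_ae ?_ (integrable_meanKernel ha (by norm_num) le_rfl)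
    (ae_invMeasure_of_ball fun y hy => ?_)
  · exact integrable_meanKernel_mul ha (by norm_num) le_rfl (continuousOn_hypS ha)
  · have h2 := meanKernel_nonneg (n := n) (s := hypS a y) (ε := 1 / 16) (by norm_num)
    rcases le_or_gt (1 / 16) (hypS a y) with h | h
    · simp only [meanKernel_of_ge (n := n) (by norm_num) h, zero_mul, le_refl]
    · exact mul_le_of_le_one_right h2 (by linarith)

end

/-! ### Barriers and the one-sided estimate at the boundary. -/

section

variable {n : ℕ} {a b x y ζ : EuclideanSpace ℝ (Fin n)}

theorem hyperbolicLaplacian_rpow {f : EuclideanSpace ℝ (Fin n) → ℝ} (hf : ContDiffAt ℝ 2 f x)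
    (h0 : 0 < f x) (β : ℝ) :
    hyperbolicLaplacian (fun y => f y ^ β) x =
      f x ^ β * (β * (β - 1) * ((1 - ‖x‖ ^ 2) ^ 2 * ∑ i, pderiv i f x ^ 2) / f x ^ 2 +
        β * hyperbolicLaplacian f x / f x) := by
  have hF : ContDiffAt ℝ 2 (fun t : ℝ => t ^ β) (f x) :=
    Real.contDiffAt_rpow_const_of_ne h0.ne'
  have h1 : deriv (fun t : ℝ => t ^ β) =ᶠ[𝓝 (f x)] fun t => β * t ^ (β - 1) := by
    filter_upwards [Ioi_mem_nhds h0] with t ht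
    exact (Real.hasDerivAt_rpow_const (Or.inl (ne_of_gt ht))).deriv
  have h2 : deriv (deriv fun t : ℝ => t ^ β) (f x) = β * ((β - 1) * f x ^ (β - 1 - 1)) := by
    rw [h1.deriv_eq]
    exact ((Real.hasDerivAt_rpow_const (Or.inl h0.ne')).const_mul β).deriv
  have h3 : deriv (fun t : ℝ => t ^ β) (f x) = β * f x ^ (β - 1) := h1.self_of_nhds
  rw [hyperbolicLaplacian_comp hF hf, h2, h3, Real.rpow_sub_one h0.ne' (β - 1),
    Real.rpow_sub_one h0.ne' β]
  field_simp

theorem mul_rpow_le {c d α : ℝ} (hc : 1 ≤ c) (hd : 0 ≤ d) (hα₁ : α ≤ 1) :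
    (c * d) ^ α ≤ c * d ^ α := by
  rw [Real.mul_rpow (by linarith) hd]
  gcongr
  calc c ^ α ≤ c ^ (1 : ℝ) := Real.rpow_le_rpow_of_exponent_le hc hα₁
    _ = c := Real.rpow_one c

/-- A supersolution at the boundary point `ζ`. -/
noncomputable def barrier (α K : ℝ) (ζ x : EuclideanSpace ℝ (Fin n)) : ℝ :=
  (‖x - ζ‖ ^ 2) ^ (α / 2) + K * (1 - ‖x‖ ^ 2) ^ α

theorem norm_sq_rpow_half (z : EuclideanSpace ℝ (Fin n)) (α : ℝ) :
    (‖z‖ ^ 2) ^ (α / 2) = ‖z‖ ^ α := by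
  rw [← Real.rpow_natCast, ← Real.rpow_mul (norm_nonneg _)]
  congr 1
  push_cast
  ring

theorem one_sub_norm_sq_le_norm_sub (hζ : ‖ζ‖ = 1) (hx : ‖x‖ ≤ 1) :
    1 - ‖x‖ ^ 2 ≤ 2 * ‖x - ζ‖ := by
  have h1 : ‖ζ‖ - ‖x‖ ≤ ‖x - ζ‖ := by
    rw [norm_sub_rev]; exact norm_sub_norm_le ζ x
  nlinarith [norm_nonneg x]

/-- With `r = ρ(x)` and `d = |x - ζ|` the Laplacian is `α² d^α (r/d)² + α(n-2) r d^α`. Since `r ≤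
2d` and `d ≤ 2`, both terms are `O(r^α)`, an error the second barrier term can absorb. -/
theorem hyperbolicLaplacian_norm_sub_rpow_le (hn : 2 ≤ n) {α : ℝ} (hα₀ : 0 < α) (hα₁ : α ≤ 1)
    (hζ : ‖ζ‖ = 1) (hx : x ∈ ball 0 1) :
    hyperbolicLaplacian (fun y => (‖y - ζ‖ ^ 2) ^ (α / 2)) x ≤
      (2 * n + 4) * (1 - ‖x‖ ^ 2) ^ α := by
  have hx1 : ‖x‖ < 1 := by simpa using hx
  have hn1 : (2 : ℝ) ≤ n := by exact_mod_cast hn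
  have hρ := one_sub_norm_sq_pos hx
  have hd := one_sub_norm_sq_le_norm_sub hζ hx1.le
  have hq : 0 < ‖x - ζ‖ ^ 2 := pow_pos (by linarith) 2
  rw [hyperbolicLaplacian_rpow (contDiff_norm_sub_sq ζ).contDiffAt hq,
    hyperbolicLaplacian_norm_sub_sq, norm_sq_rpow_half, hζ]
  have hs : ∑ i, pderiv i (fun y => ‖y - ζ‖ ^ 2) x ^ 2 = 4 * ‖x - ζ‖ ^ 2 := by
    rw [← sum_coord_sub_sq, Finset.mul_sum]
    exact Finset.sum_congr rfl fun i _ => by rw [pderiv_norm_sub_sq]; ring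
  rw [hs]
  have e : ‖x‖ ^ 2 = 1 - (1 - ‖x‖ ^ 2) := by ring
  have hd0 : 0 < ‖x - ζ‖ := by linarith
  have hd2 : ‖x - ζ‖ ≤ 2 := by linarith [norm_sub_le x ζ]
  have hρ1 : 1 - ‖x‖ ^ 2 ≤ 1 := one_sub_norm_sq_le_one
  set r := 1 - ‖x‖ ^ 2 with hr
  rw [e]
  set d := ‖x - ζ‖ with hdd
  have e2 : d ^ α * (α / 2 * (α / 2 - 1) * (r ^ 2 * (4 * d ^ 2)) / (d ^ 2) ^ 2 +
      α / 2 * (2 * ↑n * r ^ 2 + 2 * (↑n - 2) * r * (d ^ 2 + (1 - r) - 1 ^ 2)) / d ^ 2) =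
      α ^ 2 * (d ^ α * (r / d) ^ 2) + α * (n - 2) * (r * d ^ α) := by
    field_simp
    ring
  rw [e2]
  have h1 : d ^ α * (r / d) ^ 2 ≤ 4 * r ^ α := by
    have ht : 0 < r / d := by positivity
    have ht2 : r / d ≤ 2 := by rw [div_le_iff₀ hd0]; linarith
    have h3 : d ^ α * (r / d) ^ α = r ^ α := by
      rw [← Real.mul_rpow hd0.le ht.le]
      congr 1
      field_simp
    have h4 : (r / d) ^ (2 - α) ≤ 4 := by
      calc (r / d) ^ (2 - α) ≤ 2 ^ (2 - α) := Real.rpow_le_rpow ht.le ht2 (by linarith)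
        _ ≤ 2 ^ (2 : ℝ) := Real.rpow_le_rpow_of_exponent_le (by norm_num) (by linarith)
        _ = 4 := by norm_num
    calc d ^ α * (r / d) ^ 2 = d ^ α * (r / d) ^ α * (r / d) ^ (2 - α) := by
          rw [mul_assoc, ← Real.rpow_add ht, ← Real.rpow_natCast]
          congr 2
          push_cast
          ring
      _ ≤ r ^ α * 4 := by rw [h3]; gcongr
      _ = 4 * r ^ α := by ring
  have h2 : r * d ^ α ≤ 2 * r ^ α := by
    have h3 : d ^ α ≤ 2 := by
      calc d ^ α ≤ 2 ^ α := Real.rpow_le_rpow hd0.le hd2 hα₀.le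
        _ ≤ 2 ^ (1 : ℝ) := Real.rpow_le_rpow_of_exponent_le (by norm_num) hα₁
        _ = 2 := by norm_num
    have h4 : r ≤ r ^ α := by
      calc r = r ^ (1 : ℝ) := (Real.rpow_one r).symm
        _ ≤ r ^ α := Real.rpow_le_rpow_of_exponent_ge hρ hρ1 hα₁
    calc r * d ^ α ≤ r ^ α * 2 := by gcongr
      _ = _ := by ring
  have hra : 0 ≤ r ^ α := by positivity
  have hn2 : (0 : ℝ) ≤ n - 2 := by linarith
  calc _ ≤ 1 ^ 2 * (4 * r ^ α) + 1 * (n - 2) * (2 * r ^ α) := by gcongr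
    _ ≤ _ := by linarith

/-- Here `n ≥ 3` is essential: with `α ≤ 1` it gives `n - 1 - α ≥ 1`, so the coefficient of `-α r^α`
dominates `2nr + 4(1 - r) ≥ 4`. -/
theorem hyperbolicLaplacian_one_sub_norm_sq_rpow_le (hn : 3 ≤ n) {α : ℝ} (hα₀ : 0 < α)
    (hα₁ : α ≤ 1) (hx : x ∈ ball 0 1) :
    hyperbolicLaplacian (fun y => (1 - ‖y‖ ^ 2) ^ α) x ≤ -(4 * α) * (1 - ‖x‖ ^ 2) ^ α := by
  have hn1 : (3 : ℝ) ≤ n := by exact_mod_cast hn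
  have hρ := one_sub_norm_sq_pos hx
  rw [hyperbolicLaplacian_rpow contDiff_one_sub_norm_sq.contDiffAt hρ,
    hyperbolicLaplacian_one_sub_norm_sq]
  have hs : ∑ i, pderiv i (fun y => 1 - ‖y‖ ^ 2) x ^ 2 = 4 * ‖x‖ ^ 2 := by
    rw [← sum_coord_sq, Finset.mul_sum]
    exact Finset.sum_congr rfl fun i _ => by rw [pderiv_one_sub_norm_sq]; ring
  rw [hs]
  have e : ‖x‖ ^ 2 = 1 - (1 - ‖x‖ ^ 2) := by ring
  have hρ1 : 1 - ‖x‖ ^ 2 ≤ 1 := one_sub_norm_sq_le_one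
  set r := 1 - ‖x‖ ^ 2 with hr
  rw [e]
  have e2 : r ^ α * (α * (α - 1) * (r ^ 2 * (4 * (1 - r))) / r ^ 2 +
      α * -(2 * ↑n * r ^ 2 + 4 * (↑n - 2) * r * (1 - r)) / r) =
      -(α * (2 * n * r + 4 * (n - 1 - α) * (1 - r))) * r ^ α := by
    field_simp
    ring
  rw [e2]
  refine mul_le_mul_of_nonneg_right ?_ (by positivity)
  have : 4 ≤ 2 * n * r + 4 * (n - 1 - α) * (1 - r) := by
    nlinarith [mul_nonneg (by linarith : 0 ≤ n - 1 - α - 1) (by linarith : 0 ≤ 1 - r)]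
  nlinarith

theorem contDiffOn_norm_sub_rpow (hζ : ‖ζ‖ = 1) (β : ℝ) :
    ContDiffOn ℝ 2 (fun x => (‖x - ζ‖ ^ 2) ^ β) (ball 0 1) := by
  refine (contDiff_norm_sub_sq ζ).contDiffOn.rpow_const_of_ne fun x hx => ?_
  have hx1 : ‖x‖ < 1 := by simpa using hx
  have := one_sub_norm_sq_le_norm_sub hζ hx1.le
  have := one_sub_norm_sq_pos hx
  exact (pow_pos (by linarith) 2).ne'

theorem contDiffOn_one_sub_norm_sq_rpow (β : ℝ) :
    ContDiffOn ℝ 2 (fun x : EuclideanSpace ℝ (Fin n) => (1 - ‖x‖ ^ 2) ^ β) (ball 0 1) :=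
  contDiff_one_sub_norm_sq.contDiffOn.rpow_const_of_ne fun _ hx => (one_sub_norm_sq_pos hx).ne'

theorem contDiffOn_barrier (hζ : ‖ζ‖ = 1) (α K : ℝ) :
    ContDiffOn ℝ 2 (barrier α K ζ) (ball 0 1) :=
  (contDiffOn_norm_sub_rpow hζ _).add (contDiffOn_const.mul (contDiffOn_one_sub_norm_sq_rpow α))

/-- The constant `K` satisfies `4αK = 2n + 5`, one more than the error `2n + 4` of the first term.
-/
theorem hyperbolicLaplacian_barrier_le (hn : 3 ≤ n) {α : ℝ} (hα₀ : 0 < α)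
    (hα₁ : α ≤ 1) (hζ : ‖ζ‖ = 1) (hx : x ∈ ball 0 1) :
    hyperbolicLaplacian (barrier α ((2 * n + 5) / (4 * α)) ζ) x ≤ -(1 - ‖x‖ ^ 2) ^ α := by
  have h1 := hyperbolicLaplacian_norm_sub_rpow_le (by omega) hα₀ hα₁ hζ hx
  have h2 := hyperbolicLaplacian_one_sub_norm_sq_rpow_le hn hα₀ hα₁ hx
  have hc1 := contDiffAt_of_ball (contDiffOn_norm_sub_rpow hζ (α / 2)) hx
  have hc2 := contDiffAt_of_ball (contDiffOn_one_sub_norm_sq_rpow α) hx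
  have h3 : hyperbolicLaplacian (barrier α ((2 * n + 5) / (4 * α)) ζ) x = _ :=
    hyperbolicLaplacian_add hc1 (contDiffAt_const.mul hc2)
  rw [h3, hyperbolicLaplacian_const_mul hc2]
  have h4 := mul_le_mul_of_nonneg_left h2 (by positivity : 0 ≤ (2 * (n : ℝ) + 5) / (4 * α))
  have h5 : (2 * (n : ℝ) + 5) / (4 * α) * (-(4 * α) * (1 - ‖x‖ ^ 2) ^ α) =
      -((2 * n + 5) * (1 - ‖x‖ ^ 2) ^ α) := by field_simp
  linarith

theorem continuous_barrier {α : ℝ} (hα₀ : 0 < α) (K : ℝ) (ζ : EuclideanSpace ℝ (Fin n)) :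
    Continuous (barrier α K ζ) := by
  unfold barrier
  refine Continuous.add ?_ (continuous_const.mul ?_)
  · exact Continuous.rpow_const (by fun_prop) fun _ => Or.inr (by positivity)
  · exact Continuous.rpow_const (by fun_prop) fun _ => Or.inr hα₀.le

/-- An integrated maximum principle for `u - u ζ - M * barrier`. The constant is chosen before `u`,
so it serves `-u` as well. -/
theorem exists_boundary_upper_bound (hn : 3 ≤ n) {α C H : ℝ} (hα₀ : 0 < α) (hα₁ : α ≤ 1)
    (hC0 : 0 ≤ C) (hH : 0 ≤ H) : ∃ M, 0 ≤ M ∧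
    ∀ u g : EuclideanSpace ℝ (Fin n) → ℝ, ContDiffOn ℝ 2 u (ball 0 1) →
      ContinuousOn u (closedBall 0 1) → (∀ y, 0 ≤ g y) → PotentialBound g C →
      (∀ y ∈ ball 0 1, |hyperbolicLaplacian u y| ≤ (1 - ‖y‖ ^ 2) ^ (1 + α) * g y) →
      (∀ x ∈ sphere 0 1, ∀ y ∈ sphere 0 1, |u x - u y| ≤ H * ‖x - y‖ ^ α) →
      ∀ ζ ∈ sphere (0 : EuclideanSpace ℝ (Fin n)) 1,
        ∀ x ∈ closedBall (0 : EuclideanSpace ℝ (Fin n)) 1, u x - u ζ ≤ M * ‖x - ζ‖ ^ α := by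
  obtain ⟨c, hc, hlow⟩ := exists_greenFun_lower_bound n
  set K := (2 * (n : ℝ) + 5) / (4 * α) with hK
  have hK0 : 0 ≤ K := by positivity
  -- `H` handles maxima on the sphere; `2 ^ n * C / c + 1` makes the barrier outweigh the potential
  -- of `Δ_h u` at an interior maximum.
  set M := H + 2 ^ n * C / c + 1 with hM
  have hM0 : 0 ≤ M := by positivity
  refine ⟨M * (1 + K * 2), by positivity, ?_⟩
  intro u g hu huc hg hgC hug huS ζ hζ x hx
  have hζ1 : ‖ζ‖ = 1 := by simpa using hζ
  have hMc : 2 ^ n * C < M * c := by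
    rw [hM, add_mul, add_mul, div_mul_cancel₀ _ hc.ne']
    nlinarith
  set v : EuclideanSpace ℝ (Fin n) → ℝ := fun y => (u y + -u ζ) + (-M) * barrier α K ζ y with hv
  have hv2 : ContDiffOn ℝ 2 v (ball 0 1) :=
    (hu.add contDiffOn_const).add (contDiffOn_const.mul (contDiffOn_barrier hζ1 α K))
  have hvc : ContinuousOn v (closedBall 0 1) :=
    (huc.add continuousOn_const).add
      (continuousOn_const.mul (continuous_barrier hα₀ K ζ).continuousOn)
  have hvle : v x ≤ 0 := by
    obtain ⟨a, ha, hmax⟩ := (isCompact_closedBall (0 : EuclideanSpace ℝ (Fin n)) 1).exists_isMaxOn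
      ⟨x, hx⟩ hvc
    by_contra! hpos
    have hva : 0 < v a := hpos.trans_le (hmax hx)
    rcases (mem_closedBall.1 ha).lt_or_eq with hab | has
    · have hab : a ∈ ball 0 1 := hab
      have ha0 := one_sub_norm_sq_pos hab
      -- Taking the maximal value as the constant removes the point term and makes the remaining
      -- integrand nonpositive.
      have hlim := tendsto_integral_greenFun_mul (by omega) hab hv2 (v a)
      rw [sub_self, mul_zero, sub_zero] at hlim
      have h1 : ∫ y, meanKernel n (1 / 16) (hypS a y) * (v y - v a) ∂invMeasure n ≤ 0 := by
        refine integral_nonpos_of_ae (ae_invMeasure_of_ball fun y hy => ?_)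
        exact mul_nonpos_of_nonneg_of_nonpos (meanKernel_nonneg (by norm_num))
          (sub_nonpos.2 (hmax (ball_subset_closedBall hy)))
      have h2 : M * (c * (1 - ‖a‖ ^ 2) ^ α) - 2 ^ n * C * (1 - ‖a‖ ^ 2) ^ α ≤
          ∫ y, meanKernel n (1 / 16) (hypS a y) * (v y - v a) ∂invMeasure n := by
        refine ge_of_tendsto hlim ?_
        filter_upwards [Ioo_mem_nhdsGT (show (0 : ℝ) < 1 / 64 by norm_num)] with ε hε
        have hε2 : ε ≤ 1 / 16 := by linarith [hε.2]
        have h3 := hlow a ε α hab hε.1 hε.2.le hα₀.le hα₁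
        have h4 := neg_le_of_abs_le (abs_integral_greenFun_mul_le (by omega) hα₀.le hα₁ hgC hug
          hg hab hε.1 hε2)
        have hi1 := integrable_greenFun_mul hab hε.1 hε2
          (contDiffOn_one_sub_norm_sq_rpow (n := n) α).continuousOn
        have hi2 := integrable_greenFun_mul hab hε.1 hε2 (continuousOn_hyperbolicLaplacian hu)
        have h5 : M * ∫ y, greenFun n ε (hypS a y) * (1 - ‖y‖ ^ 2) ^ α ∂invMeasure n +
            ∫ y, greenFun n ε (hypS a y) * hyperbolicLaplacian u y ∂invMeasure n ≤
            ∫ y, greenFun n ε (hypS a y) * hyperbolicLaplacian v y ∂invMeasure n := by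
          rw [← integral_const_mul, ← integral_add (hi1.const_mul M) hi2]
          refine integral_mono_ae ((hi1.const_mul M).add hi2) (integrable_greenFun_mul hab hε.1 hε2
            (continuousOn_hyperbolicLaplacian hv2)) (ae_invMeasure_of_ball fun y hy => ?_)
          have hcu := contDiffAt_of_ball hu hy
          have hcB := contDiffAt_of_ball (contDiffOn_barrier hζ1 α K) hy
          have e : hyperbolicLaplacian v y =
              hyperbolicLaplacian u y + (-M) * hyperbolicLaplacian (barrier α K ζ) y := by
            rw [hv, hyperbolicLaplacian_add (hcu.add contDiffAt_const) (contDiffAt_const.mul hcB),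
              hyperbolicLaplacian_add hcu contDiffAt_const, hyperbolicLaplacian_const,
              hyperbolicLaplacian_const_mul hcB, add_zero]
          have h6 := hyperbolicLaplacian_barrier_le hn hα₀ hα₁ hζ1 hy
          have h7 := greenFun_nonneg (n := n) (s := hypS a y) hε.1 hε2
          simp only [e]
          have h8 : M * (1 - ‖y‖ ^ 2) ^ α ≤ (-M) * hyperbolicLaplacian (barrier α K ζ) y := by
            have := mul_le_mul_of_nonneg_left h6 hM0
            linarith
          calc _ = greenFun n ε (hypS a y) *
                (hyperbolicLaplacian u y + M * (1 - ‖y‖ ^ 2) ^ α) := by ring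
            _ ≤ _ := by gcongr
        have h6 := mul_le_mul_of_nonneg_left h3 hM0
        linarith
      have h3 : 0 < (M * c - 2 ^ n * C) * (1 - ‖a‖ ^ 2) ^ α :=
        mul_pos (sub_pos.2 hMc) (by positivity)
      linarith
    · have has1 : ‖a‖ = 1 := by simpa using has
      have h1 := (le_abs_self _).trans (huS a (by simpa using has1) ζ hζ)
      have h2 : barrier α K ζ a = ‖a - ζ‖ ^ α := by
        rw [barrier, norm_sq_rpow_half, has1]
        simp [Real.zero_rpow hα₀.ne']
      have h3 : H * ‖a - ζ‖ ^ α ≤ M * ‖a - ζ‖ ^ α := by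
        gcongr
        have : 0 ≤ 2 ^ n * C / c := by positivity
        linarith
      simp only [hv, h2] at hva
      linarith
  have h1 : (1 - ‖x‖ ^ 2) ^ α ≤ 2 * ‖x - ζ‖ ^ α := by
    have hx1 : ‖x‖ ≤ 1 := by simpa using hx
    refine le_trans (Real.rpow_le_rpow ?_ (one_sub_norm_sq_le_norm_sub hζ1 hx1) hα₀.le)
      (mul_rpow_le (by norm_num) (norm_nonneg _) hα₁)
    nlinarith [norm_nonneg x]
  simp only [hv, barrier, norm_sq_rpow_half] at hvle
  have h2 : M * (‖x - ζ‖ ^ α + K * (1 - ‖x‖ ^ 2) ^ α) ≤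
      M * (‖x - ζ‖ ^ α + K * (2 * ‖x - ζ‖ ^ α)) := by gcongr
  linarith

end

/-! ### Two-sided boundary bound, interior bound, and their combination. -/

section

variable {n : ℕ} {a b x y ζ : EuclideanSpace ℝ (Fin n)}

theorem exists_sphere_point (hn : 1 ≤ n) (hx : ‖x‖ ≤ 1) :
    ∃ ζ ∈ sphere (0 : EuclideanSpace ℝ (Fin n)) 1, ‖x - ζ‖ ≤ 1 - ‖x‖ ^ 2 := by
  by_cases h0 : x = 0
  · refine ⟨EuclideanSpace.single ⟨0, hn⟩ 1, by simp, ?_⟩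
    simp [h0]
  · have hx0 : 0 < ‖x‖ := norm_pos_iff.2 h0
    refine ⟨(‖x‖)⁻¹ • x, ?_, ?_⟩
    · rw [mem_sphere_zero_iff_norm, norm_smul, norm_inv, norm_norm, inv_mul_cancel₀ hx0.ne']
    · have e : x - (‖x‖)⁻¹ • x = (1 - (‖x‖)⁻¹) • x := by rw [sub_smul, one_smul]
      have h1 : 1 - ‖x‖⁻¹ ≤ 0 := sub_nonpos.2 ((one_le_inv₀ hx0).2 hx)
      rw [e, norm_smul, Real.norm_of_nonpos h1]
      have : -(1 - ‖x‖⁻¹) * ‖x‖ = 1 - ‖x‖ := by field_simp; ring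
      rw [this]
      nlinarith

theorem hyperbolicLaplacian_neg {u : EuclideanSpace ℝ (Fin n) → ℝ} (hu : ContDiffAt ℝ 2 u x) :
    hyperbolicLaplacian (fun y => -u y) x = -hyperbolicLaplacian u x := by
  have := hyperbolicLaplacian_const_mul hu (-1)
  simpa using this

/-- Hölder continuity of scalar functions at boundary points. -/
theorem exists_boundary_bound (hn : 3 ≤ n) {α C H : ℝ} (hα₀ : 0 < α) (hα₁ : α ≤ 1)
    (hC0 : 0 ≤ C) (hH : 0 ≤ H) {u g : EuclideanSpace ℝ (Fin n) → ℝ}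
    (hu : ContDiffOn ℝ 2 u (ball 0 1)) (huc : ContinuousOn u (closedBall 0 1))
    (hg : ∀ y, 0 ≤ g y) (hgC : PotentialBound g C)
    (hug : ∀ y ∈ ball 0 1, |hyperbolicLaplacian u y| ≤ (1 - ‖y‖ ^ 2) ^ (1 + α) * g y)
    (huS : ∀ x ∈ sphere 0 1, ∀ y ∈ sphere 0 1, |u x - u y| ≤ H * ‖x - y‖ ^ α) :
    ∃ M, 0 ≤ M ∧ ∀ ζ ∈ sphere (0 : EuclideanSpace ℝ (Fin n)) 1,
      ∀ x ∈ closedBall (0 : EuclideanSpace ℝ (Fin n)) 1, |u x - u ζ| ≤ M * ‖x - ζ‖ ^ α := by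
  obtain ⟨M, hM, h⟩ := exists_boundary_upper_bound hn hα₀ hα₁ hC0 hH
  refine ⟨M, hM, fun ζ hζ x hx => abs_le.2 ⟨?_, h u g hu huc hg hgC hug huS ζ hζ x hx⟩⟩
  have := h (fun y => -u y) g hu.neg huc.neg hg hgC
    (fun y hy => by
      rw [hyperbolicLaplacian_neg (contDiffAt_of_ball hu hy), abs_neg]
      exact hug y hy)
    (fun x hx y hy => by rw [← abs_neg]; convert huS x hx y hy using 2; ring) ζ hζ x hx
  linarith

/-- An interior Lipschitz estimate at the hyperbolic scale. -/
theorem exists_interior_bound (hn : 3 ≤ n) {α C M : ℝ} (hα₀ : 0 < α) (hα₁ : α ≤ 1)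
    (hC0 : 0 ≤ C) (hM : 0 ≤ M) {u g : EuclideanSpace ℝ (Fin n) → ℝ}
    (hu : ContDiffOn ℝ 2 u (ball 0 1))
    (hg : ∀ y, 0 ≤ g y) (hgC : PotentialBound g C)
    (hug : ∀ y ∈ ball 0 1, |hyperbolicLaplacian u y| ≤ (1 - ‖y‖ ^ 2) ^ (1 + α) * g y)
    (hM' : ∀ ζ ∈ sphere (0 : EuclideanSpace ℝ (Fin n)) 1,
      ∀ x ∈ closedBall (0 : EuclideanSpace ℝ (Fin n)) 1, |u x - u ζ| ≤ M * ‖x - ζ‖ ^ α) :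
    ∃ A, 0 ≤ A ∧ ∀ a ∈ ball (0 : EuclideanSpace ℝ (Fin n)) 1,
      ∀ b ∈ ball (0 : EuclideanSpace ℝ (Fin n)) 1, ‖a - b‖ ≤ (1 - ‖a‖ ^ 2) / 16 →
      |u a - u b| ≤ A * ((1 - ‖a‖ ^ 2) ^ α * (‖a - b‖ / (1 - ‖a‖ ^ 2))) := by
  obtain ⟨κ, hκ, hmass⟩ := exists_kernelMass_lower_bound (n := n) (by omega)
  obtain ⟨L, hL, hLip⟩ := exists_meanKernel_sub_bound n (by omega)
  refine ⟨(48 * 2 ^ n * C + L * (4 * M)) / κ, by positivity, fun a ha b hb hab => ?_⟩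
  have ha0 := one_sub_norm_sq_pos ha
  set D := ‖a - b‖ / (1 - ‖a‖ ^ 2) with hD
  have hD0 : 0 ≤ D := by positivity
  set T := (1 - ‖a‖ ^ 2) ^ α with hT
  have hT0 : 0 ≤ T := by positivity
  have hosc : ∀ y ∈ ball (0 : EuclideanSpace ℝ (Fin n)) 1, ‖y - a‖ ≤ (1 - ‖a‖ ^ 2) / 2 →
      |u y - u b| ≤ 4 * M * T := by
    intro y hy hya
    obtain ⟨ζ, hζ, haζ⟩ := exists_sphere_point (n := n) (x := a) (by omega)
      (by simpa using ball_subset_closedBall ha)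
    have key : ∀ z ∈ ball (0 : EuclideanSpace ℝ (Fin n)) 1, ‖z - a‖ ≤ (1 - ‖a‖ ^ 2) / 2 →
        |u z - u ζ| ≤ M * (2 * T) := by
      intro z hz hza
      -- Here `|z - ζ| ≤ ρ(a)/2 + ρ(a) ≤ 2ρ(a)`.
      refine (hM' ζ hζ z (ball_subset_closedBall hz)).trans ?_
      gcongr
      refine le_trans (Real.rpow_le_rpow (norm_nonneg _) ?_ hα₀.le)
        (mul_rpow_le one_le_two ha0.le hα₁)
      linarith [norm_sub_le_norm_sub_add_norm_sub z a ζ]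
    have h1 := key y hy hya
    have h2 := key b hb (by rw [norm_sub_rev]; linarith)
    calc |u y - u b| = |(u y - u ζ) - (u b - u ζ)| := by congr 1; ring
      _ ≤ |u y - u ζ| + |u b - u ζ| := abs_sub _ _
      _ ≤ 4 * M * T := by linarith
  -- Both formulas use the constant `u b`: the point term at `b` vanishes, so the masses at `a` and
  -- `b` never have to be compared.
  have hla := tendsto_integral_greenFun_mul (by omega) ha hu (u b)
  have hlb := tendsto_integral_greenFun_mul (by omega) hb hu (u b)
  have hlim := (hla.sub hlb).abs
  have hbound := le_of_tendsto (b := 48 * 2 ^ n * C * T * D) hlim (by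
    filter_upwards [Ioo_mem_nhdsGT (show (0 : ℝ) < 1 / 64 by norm_num)] with ε hε
    have hε2 : ε ≤ 1 / 16 := by linarith [hε.2]
    have hc := continuousOn_hyperbolicLaplacian hu
    rw [← integral_sub (integrable_greenFun_mul ha hε.1 hε2 hc)
      (integrable_greenFun_mul hb hε.1 hε2 hc)]
    simp only [← sub_mul]
    exact abs_integral_greenFun_sub_mul_le (by omega) hα₀.le hα₁ hgC hug hg ha hb hab hε.1 hε2)
  have hcu : ContinuousOn (fun y => u y - u b) (ball 0 1) := hu.continuousOn.sub continuousOn_const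
  have hk := hLip (fun y => u y - u b) (4 * M * T) a b (by positivity) ha hb hab hosc
  simp only [sub_mul] at hk
  rw [integral_sub (integrable_meanKernel_mul ha (by norm_num) le_rfl hcu)
    (integrable_meanKernel_mul hb (by norm_num) le_rfl hcu)] at hk
  rw [sub_self, mul_zero, sub_zero] at hbound
  have h1 : κ * |u a - u b| ≤ 48 * 2 ^ n * C * T * D + L * (4 * M * T) * D := by
    calc κ * |u a - u b| ≤ kernelMass a * |u a - u b| := by gcongr; exact hmass a ha
      _ = |kernelMass a * (u a - u b)| := by
          rw [abs_mul, abs_of_nonneg (hκ.le.trans (hmass a ha))]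
      _ ≤ _ := by
          rw [abs_le] at *
          constructor <;> linarith [hbound.1, hbound.2, hk.1, hk.2]
  rw [div_mul_eq_mul_div, le_div_iff₀ hκ]
  linarith

/-- If `|x - y| < ρ(x)/16`, use the interior bound, or the boundary bound when `y` is on the sphere.
Otherwise a boundary point `ζ` with `|x - ζ| ≤ ρ(x) ≤ 16|x - y|` joins them, and `|y - ζ| ≤ 17|x -
y|`, whence `33 = 16 + 17`. -/
theorem exists_holder_bound (hn : 3 ≤ n) {α C H : ℝ} (hα₀ : 0 < α) (hα₁ : α ≤ 1)
    (hC0 : 0 ≤ C) (hH : 0 ≤ H) {u g : EuclideanSpace ℝ (Fin n) → ℝ}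
    (hu : ContDiffOn ℝ 2 u (ball 0 1)) (huc : ContinuousOn u (closedBall 0 1))
    (hg : ∀ y, 0 ≤ g y) (hgC : PotentialBound g C)
    (hug : ∀ y ∈ ball 0 1, |hyperbolicLaplacian u y| ≤ (1 - ‖y‖ ^ 2) ^ (1 + α) * g y)
    (huS : ∀ x ∈ sphere 0 1, ∀ y ∈ sphere 0 1, |u x - u y| ≤ H * ‖x - y‖ ^ α) :
    ∃ A, 0 ≤ A ∧ ∀ x ∈ closedBall (0 : EuclideanSpace ℝ (Fin n)) 1,
      ∀ y ∈ closedBall (0 : EuclideanSpace ℝ (Fin n)) 1, |u x - u y| ≤ A * ‖x - y‖ ^ α := by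
  obtain ⟨M, hM, hbd⟩ := exists_boundary_bound hn hα₀ hα₁ hC0 hH hu huc hg hgC hug huS
  obtain ⟨A, hA, hint⟩ := exists_interior_bound hn hα₀ hα₁ hC0 hM hu hg hgC hug hbd
  refine ⟨A + 33 * M, by positivity, fun x hx y hy => ?_⟩
  have hd0 : 0 ≤ ‖x - y‖ ^ α := by positivity
  by_cases hxy : ‖x - y‖ < (1 - ‖x‖ ^ 2) / 16
  · have hx0 : 0 < 1 - ‖x‖ ^ 2 := by linarith [norm_nonneg (x - y)]
    rcases (mem_closedBall.1 hy).lt_or_eq with hyb | hys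
    · have hxb : x ∈ ball 0 1 := by
        rw [mem_ball_zero_iff]; nlinarith [norm_nonneg x]
      have h1 := hint x hxb y hyb hxy.le
      have h2 : (1 - ‖x‖ ^ 2) ^ α * (‖x - y‖ / (1 - ‖x‖ ^ 2)) ≤ ‖x - y‖ ^ α := by
        set D := ‖x - y‖ / (1 - ‖x‖ ^ 2) with hD
        have hD0 : 0 ≤ D := by positivity
        have hD1 : D ≤ 1 := by rw [hD, div_le_one hx0]; linarith
        -- A Lipschitz bound in the scaled distance `D ≤ 1` is stronger than a Hölder one.
        have h3 : D ≤ D ^ α := Real.self_le_rpow_of_le_one hD0 hD1 hα₁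
        calc _ ≤ (1 - ‖x‖ ^ 2) ^ α * D ^ α := by gcongr
          _ = ((1 - ‖x‖ ^ 2) * D) ^ α := (Real.mul_rpow hx0.le hD0).symm
          _ = ‖x - y‖ ^ α := by rw [hD]; congr 1; field_simp
      nlinarith [mul_le_mul_of_nonneg_left h2 hA, mul_nonneg hM hd0]
    · have h1 := hbd y hys x hx
      nlinarith [mul_nonneg hM hd0, mul_nonneg hA hd0]
  · rw [not_lt] at hxy
    obtain ⟨ζ, hζ, hxζ⟩ := exists_sphere_point (n := n) (x := x) (by omega) (by simpa using hx)
    have h1 := hbd ζ hζ x hx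
    have h2 := hbd ζ hζ y hy
    have h3 : ‖x - ζ‖ ^ α ≤ 16 * ‖x - y‖ ^ α :=
      (Real.rpow_le_rpow (norm_nonneg _) (by linarith) hα₀.le).trans
        (mul_rpow_le (by norm_num) (norm_nonneg _) hα₁)
    have h4 : ‖y - ζ‖ ^ α ≤ 17 * ‖x - y‖ ^ α := by
      refine (Real.rpow_le_rpow (norm_nonneg _) ?_ hα₀.le).trans
        (mul_rpow_le (by norm_num) (norm_nonneg _) hα₁)
      have := norm_sub_le_norm_sub_add_norm_sub y x ζ
      rw [norm_sub_rev y x] at this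
      linarith
    calc |u x - u y| = |(u x - u ζ) - (u y - u ζ)| := by congr 1; ring
      _ ≤ |u x - u ζ| + |u y - u ζ| := abs_sub _ _
      _ ≤ M * (16 * ‖x - y‖ ^ α) + M * (17 * ‖x - y‖ ^ α) :=
          add_le_add (h1.trans (by gcongr)) (h2.trans (by gcongr))
      _ ≤ _ := by nlinarith [mul_nonneg hA hd0]

/-- The ball has finite measure, so `p`, possibly infinite, may be lowered to a finite exponent
still above `n`. -/
theorem exists_potentialBound_of_memLp (hn : 2 ≤ n) {F : Type*} [NormedAddCommGroup F]
    {ψ : EuclideanSpace ℝ (Fin n) → F} {p : ℝ≥0∞} (hp : (n : ℝ≥0∞) < p)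
    (hψ : MemLp ψ p (ballMeasure n)) :
    ∃ C, 0 ≤ C ∧ PotentialBound (fun y => ‖ψ y‖) C := by
  obtain ⟨r, hr1, hr2⟩ := ENNReal.lt_iff_exists_nnreal_btwn.1 hp
  have hnr : (n : ℝ) < r := by
    have : (n : ℝ≥0) < r := by exact_mod_cast hr1
    exact_mod_cast this
  have hr0 : (r : ℝ≥0∞) ≠ 0 := (bot_le.trans_lt hr1).ne'
  have hψ' : MemLp ψ p (volume.restrict (ball 0 1)) := by
    have := hψ.smul_measure (c := volume (ball (0 : EuclideanSpace ℝ (Fin n)) 1))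
      measure_ball_lt_top.ne
    rwa [ballMeasure, smul_smul, ENNReal.mul_inv_cancel
      (measure_ball_pos volume 0 one_pos).ne' measure_ball_lt_top.ne, one_smul] at this
  have : IsFiniteMeasure (volume.restrict (ball (0 : EuclideanSpace ℝ (Fin n)) 1)) :=
    ⟨by rw [Measure.restrict_apply_univ]; exact measure_ball_lt_top⟩
  have hr := (hψ'.mono_exponent hr2.le).integrable_norm_rpow hr0 ENNReal.coe_ne_top
  rw [ENNReal.coe_toReal] at hr
  exact exists_potentialBound hn hnr (fun y => norm_nonneg _) hψ'.1.norm hr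

end

end HyperbolicBall

/-! ### Reduction of the vector-valued statement to coordinates. -/

theorem mainTheorem6 (n : ℕ) (hn : 3 ≤ n)
    (u : EuclideanSpace ℝ (Fin n) → EuclideanSpace ℝ (Fin n))
    (hu : ContDiffOn ℝ 2 u (ball 0 1))
    (huc : ContinuousOn u (closedBall 0 1))
    (α : ℝ≥0) (hα₀ : 0 < α) (hα₁ : α ≤ 1)
    (p : ℝ≥0∞) (hp : (n : ℝ≥0∞) < p)
    (hψ : MemLp (fun y : EuclideanSpace ℝ (Fin n) =>
      ((1 - ‖y‖ ^ 2) ^ (-1 - (α : ℝ)) : ℝ) • hyperbolicLaplacian u y) p (ballMeasure n))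
    (hS : IsHolderOn α u (sphere 0 1)) :
    IsHolderOn α u (closedBall 0 1) := by
  obtain ⟨C, hC0, hC⟩ := HyperbolicBall.exists_potentialBound_of_memLp (by omega) hp hψ
  obtain ⟨H, hH⟩ := hS
  have hcoord : ∀ i : Fin n, ∃ A : ℝ, 0 ≤ A ∧
      ∀ x ∈ closedBall (0 : EuclideanSpace ℝ (Fin n)) 1,
      ∀ y ∈ closedBall (0 : EuclideanSpace ℝ (Fin n)) 1,
        |u x i - u y i| ≤ A * ‖x - y‖ ^ (α : ℝ) := by
    intro i
    let l : EuclideanSpace ℝ (Fin n) →L[ℝ] ℝ := EuclideanSpace.proj i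
    refine HyperbolicBall.exists_holder_bound hn (by exact_mod_cast hα₀) (by exact_mod_cast hα₁)
      hC0 H.coe_nonneg (u := fun x => l (u x)) (l.contDiff.comp_contDiffOn hu)
      (l.continuous.comp_continuousOn huc) (fun y => norm_nonneg _) hC ?_ ?_
    · intro y hy
      have hρ := HyperbolicBall.one_sub_norm_sq_pos hy
      have e : hyperbolicLaplacian (fun x => l (u x)) y = l (hyperbolicLaplacian u y) :=
        HyperbolicBall.hyperbolicLaplacian_clm_comp (hu.contDiffAt (isOpen_ball.mem_nhds hy)) l
      -- With `g` the norm of the weighted Laplacian, the weights `ρ^(1+α)` and `ρ^(-1-α)` cancel,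
      -- so a single `g` and `C` serve every coordinate.
      rw [e, norm_smul, Real.norm_of_nonneg (by positivity), ← mul_assoc, ← Real.rpow_add hρ]
      simp only [add_add_sub_cancel, add_neg_cancel, Real.rpow_zero, one_mul]
      exact PiLp.norm_apply_le (hyperbolicLaplacian u y) i
    · intro x hx y hy
      have h1 := hH.dist_le hx hy
      rw [dist_eq_norm, dist_eq_norm] at h1
      refine le_trans ?_ h1
      exact PiLp.norm_apply_le (u x - u y) i
  choose A hA0 hA using hcoord
  refine ⟨(∑ i, A i).toNNReal, fun x hx y hy => ?_⟩
  have h1 : ‖u x - u y‖ ≤ (∑ i, A i) * ‖x - y‖ ^ (α : ℝ) := by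
    have h2 : ‖u x - u y‖ ≤ ∑ i, |u x i - u y i| := by
      rw [EuclideanSpace.norm_eq, Real.sqrt_le_iff]
      refine ⟨Finset.sum_nonneg fun i _ => abs_nonneg _, ?_⟩
      exact Finset.sum_sq_le_sq_sum_of_nonneg fun i _ => abs_nonneg _
    refine h2.trans ?_
    rw [Finset.sum_mul]
    exact Finset.sum_le_sum fun i _ => hA i x hx y hy
  rw [edist_dist, edist_dist, dist_eq_norm, dist_eq_norm,
    ENNReal.ofReal_rpow_of_nonneg (norm_nonneg _) α.coe_nonneg]
  change _ ≤ ENNReal.ofReal (∑ i, A i) * _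
  rw [← ENNReal.ofReal_mul (Finset.sum_nonneg fun i _ => hA0 i)]
  exact ENNReal.ofReal_le_ofReal h1
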